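/- **Setting.** In the $p$-processor cup game on $n$ cups, each step consists of a move of the filler followed by a move of the emptier. The filler distributes $p$ units of water among the cups, at most $1$ unit into each cup. The emptier then removes $1$ unit of water from each of up to $p$ distinct cups. The filler is oblivious: its (possibly randomized) moves are chosen independently of the emptier's random choices. The emptier follows the *asymmetric smoothed greedy algorithm*. Before the game it chooses, for every cup $j$, an offset $r_j\in[0,1)$ and a priority $p_j\in[0,1)$, all independent and uniformly random, and cup $j$ starts with fill $r_j$. In each step, after the filler's move: if at least $p$ cups have fill $\ge 2$, it removes $1$ unit from each of the $p$ fullest cups. Otherwise it removes $1$ unit from each cup of fill $\ge 2$ and uses its remaining removals on cups with fill in $[1,2)$, in decreasing order of $p_j$, until $p$ cups have been chosen or there are no such cups left. It never removes water from a cup with fill less than $1$. The *tail size* after a step is the number of cups with fill $\ge 2$; the *backlog* is the fill of the fullest cup (fills include the offsets). **Theorem 4.7.** For all constants $c,d\in\mathbb N$ there is a constant $C>0$, depending only on $c$ and $d$, such that the following holds for all $n\ge 3$, all $p\ge 1$, all $T\le n^d$, and every oblivious filler in the $p$-processor cup game on $n$ cups of length $T$. If the emptier follows the asymmetric smoothed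 greedy algorithm, then with probability at least $1-n^{-c}$, after every step of the game simultaneously, the tail size is at most $$C\,(\log n\,\log\log n + p\log p)$$ and the backlog is at most $$C\,(\log\log n+\log p).$$ -/

import Mathlib

open MeasureTheory

namespace CupGame

/-- A sequence of `T` legal filler moves in the `p`-processor cup game on `n` cups: in every step the
filler distributes `p` units of water in total, at most `1` unit into each cup. The value `F t j` is
the amount poured into cup `j` in the `t`-th step (steps are counted from `0`). -/
def IsFilling {n : ℕ} (p T : ℕ) (F : ℕ → Fin n → ℝ) : Prop :=
  ∀ t < T, (∀ j, 0 ≤ F t j ∧ F t j ≤ 1) ∧ ∑ j, F t j = (p : ℝ)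

/-- For cups of fill at least `1`, the emptier prefers cup `i` to cup `j`, when the fills are `x` and
the priorities are `prio`: cups of fill at least `2` come before the others; among cups of fill at
least `2` the fuller one comes first; among cups of fill below `2` the one of larger priority comes
first. Exact ties (an event of probability zero) are broken by the index. -/
def Prefers {n : ℕ} (prio x : Fin n → ℝ) (i j : Fin n) : Prop :=
  (2 ≤ x i ∧ x j < 2) ∨
  (2 ≤ x i ∧ 2 ≤ x j ∧ (x j < x i ∨ (x i = x j ∧ i < j))) ∨
  (x i < 2 ∧ x j < 2 ∧ (prio j < prio i ∨ (prio i = prio j ∧ i < j)))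

open Classical in
/-- The cups that the emptier removes water from: the `p` most preferred ones among the cups of fill
at least `1` (all of these, if there are at most `p`). -/
noncomputable def selected {n : ℕ} (p : ℕ) (prio x : Fin n → ℝ) : Finset (Fin n) :=
  {j | 1 ≤ x j ∧ (Finset.univ.filter fun i => 1 ≤ x i ∧ Prefers prio x i j).card < p}

open Classical in
/-- The emptier's move: `1` unit of water is removed from each selected cup. -/
noncomputable def emptyStep {n : ℕ} (p : ℕ) (prio x : Fin n → ℝ) : Fin n → ℝ :=
  fun j => if j ∈ selected p prio x then x j - 1 else x j

/-- The fills of the cups after `t` steps (filler's move, then emptier's move) under the asymmetric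
smoothed greedy algorithm with initial offsets `r` and priorities `prio`, against the filler moves
`F`. Before the first step, cup `j` holds its offset `r j`. -/
noncomputable def fill {n : ℕ} (p : ℕ) (F : ℕ → Fin n → ℝ) (r prio : Fin n → ℝ) : ℕ → Fin n → ℝ
  | 0 => r
  | t + 1 => emptyStep p prio (fun j => fill p F r prio t j + F t j)

/-- The tail size: the number of cups containing `2` or more units of water. -/
noncomputable def tailSize {n : ℕ} (x : Fin n → ℝ) : ℕ :=
  Set.ncard {j | 2 ≤ x j}

/-- The backlog: the amount of water in the fullest cup. -/
noncomputable def backlog {n : ℕ} (x : Fin n → ℝ) : ℝ :=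
  ⨆ j, x j

/-- The law of `n` independent uniformly random numbers from `[0, 1)`. -/
noncomputable def uniformVec (n : ℕ) : Measure (Fin n → ℝ) :=
  Measure.pi fun _ => (volume : Measure ℝ).restrict (Set.Ico 0 1)

end CupGame

/-! A fill differs from offset plus poured water by an integer, so the crossings of integer levels
depend only on the offsets and the filler, never on the emptier (`floor_fill_add`). Against an
oblivious filler, the crossings in a fixed window of steps are therefore sums of independent
variables. With high probability every window is a `TypicalWindow` (`prob_typical_ge`); the rest is
deterministic.

Tail from backlog (`tokenSum_le`). Let `β` bound the backlog, and take the thresholds `i / m` with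
`m` about `2 log log n`. Look back to the last time with fewer than `p` urgent cups: at most `p * β`
tokens were left. Since then each step has removed `p` tokens, while the crossings supply `p` per
step up to a deviation of order `√(L * M) + L`, where `M` is `active`. A low-priority cup that
starts below `1` takes in its first unit without creating a token. About `M / m` cups of the class
between two consecutive thresholds cross an integer, and those among them that started at `1` or
more are counted by the tokens of the lower threshold. This gain of order `M / m` beats `√(L * M)`
when `M` is large, so the token counts satisfy `X (i + 1) ≲ p * β + L * m + √(L * m * X i)`.
Starting from order `n + p * β`, repeated square roots leave order `p * β + L * m` after `m` levels,
with `L` of order `log n`.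

Backlog from tail (`fill_le_of_tailSize_le`). If the tail size never exceeds `S`, the excess over
`2` in any `k` cups stays below a concave function `cap` of `k`, and its value at `1` is of order
`log (S + p)`.

Alternating the two (`bounds_of_typical`): tail at most `n`, backlog `O(log n)`, tail `O(p log² n)`,
backlog `O(log log n + log p)`, and finally the claimed tail bound. -/

namespace CupGame

/-! ### Ranks in finite strict total orders -/

section Rank

variable {α : Type*}

open Classical in
/-- The number of elements of `U` that precede `j` in the relation `R`. -/
noncomputable def rankIn (R : α → α → Prop) (U : Finset α) (j : α) : ℕ :=
  (U.filter fun i => R i j).card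

lemma rankIn_lt {R : α → α → Prop} (hirr : ∀ i, ¬ R i i)
    (htr : ∀ i j k, R i j → R j k → R i k) {U : Finset α} {i j : α} (hi : i ∈ U) (h : R i j) :
    rankIn R U i < rankIn R U j := by
  classical
  apply Finset.card_lt_card
  rw [Finset.ssubset_iff_of_subset]
  · exact ⟨i, by simp [hi, h], by simp [hirr]⟩
  · intro k hk
    simp only [Finset.mem_filter] at hk ⊢
    exact ⟨hk.1, htr _ _ _ hk.2 h⟩

lemma rankIn_lt_card {R : α → α → Prop} (hirr : ∀ i, ¬ R i i) {U : Finset α} {j : α}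
    (hj : j ∈ U) : rankIn R U j < U.card := by
  classical
  apply Finset.card_lt_card
  rw [Finset.ssubset_iff_of_subset (Finset.filter_subset _ _)]
  exact ⟨j, hj, by simp [hirr]⟩

open Classical in
/-- In a finite strict total order with at least `p` elements, exactly `p` elements have fewer
than `p` predecessors. -/
lemma card_filter_rankIn_lt {R : α → α → Prop} (hirr : ∀ i, ¬ R i i)
    (htr : ∀ i j k, R i j → R j k → R i k) (htot : ∀ i j, i ≠ j → R i j ∨ R j i)
    {U : Finset α} {p : ℕ} (hp : p ≤ U.card) :
    (U.filter fun j => rankIn R U j < p).card = p := by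
  have hinj : Set.InjOn (rankIn R U) U := by
    intro i hi j hj hij
    by_contra hne
    rcases htot i j hne with h | h
    · exact absurd hij (rankIn_lt hirr htr hi h).ne
    · exact absurd hij (rankIn_lt hirr htr hj h).ne'
  have himg : U.image (rankIn R U) = Finset.range U.card := by
    apply Finset.eq_of_subset_of_card_le
    · intro k hk
      obtain ⟨j, hj, rfl⟩ := Finset.mem_image.1 hk
      exact Finset.mem_range.2 (rankIn_lt_card hirr hj)
    · rw [Finset.card_image_of_injOn hinj, Finset.card_range]
  have h2 : (U.filter fun j => rankIn R U j < p).image (rankIn R U) = Finset.range p := by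
    ext k
    simp only [Finset.mem_image, Finset.mem_filter, Finset.mem_range]
    constructor
    · rintro ⟨j, ⟨_, h⟩, rfl⟩
      exact h
    · intro hk
      have : k ∈ U.image (rankIn R U) := by
        rw [himg]
        exact Finset.mem_range.2 (lt_of_lt_of_le hk hp)
      obtain ⟨j, hj, rfl⟩ := Finset.mem_image.1 this
      exact ⟨j, ⟨hj, hk⟩, rfl⟩
  rw [← Finset.card_image_of_injOn (hinj.mono (by intro x hx; exact (Finset.mem_filter.1 hx).1)), h2,
    Finset.card_range]

end Rank

/-! ### The emptier's choice and the urgent cups -/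

variable {n : ℕ}

lemma prefers_irrefl (prio x : Fin n → ℝ) (i : Fin n) : ¬ Prefers prio x i i := by
  unfold Prefers
  grind

lemma prefers_trans (prio x : Fin n → ℝ) (i j k : Fin n) :
    Prefers prio x i j → Prefers prio x j k → Prefers prio x i k := by
  unfold Prefers
  grind

lemma prefers_total (prio x : Fin n → ℝ) (i j : Fin n) (h : i ≠ j) :
    Prefers prio x i j ∨ Prefers prio x j i := by
  unfold Prefers
  grind

open Classical in
/-- The cups of fill at least `1`. -/
noncomputable def servable (x : Fin n → ℝ) : Finset (Fin n) := {j | 1 ≤ x j}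

open Classical in
/-- The cups of fill at least `2`, together with the cups of fill at least `1` and of priority at
least `θ`. -/
noncomputable def urgent (prio : Fin n → ℝ) (θ : ℝ) (x : Fin n → ℝ) : Finset (Fin n) :=
  {j | 2 ≤ x j ∨ (1 ≤ x j ∧ θ ≤ prio j)}

lemma mem_urgent {prio : Fin n → ℝ} {θ : ℝ} {x : Fin n → ℝ} {j : Fin n} :
    j ∈ urgent prio θ x ↔ 2 ≤ x j ∨ (1 ≤ x j ∧ θ ≤ prio j) := by
  simp [urgent]

lemma mem_selected {p : ℕ} {prio x : Fin n → ℝ} {j : Fin n} :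
    j ∈ selected p prio x ↔
      j ∈ servable x ∧ rankIn (Prefers prio x) (servable x) j < p := by
  classical
  simp only [selected, servable, rankIn, Finset.mem_filter, Finset.mem_univ, true_and,
    Finset.filter_filter]

lemma one_le_of_mem_selected {p : ℕ} {prio x : Fin n → ℝ} {j : Fin n}
    (h : j ∈ selected p prio x) : 1 ≤ x j := by
  simpa [servable] using (mem_selected.1 h).1

lemma urgent_subset_servable (prio : Fin n → ℝ) (θ : ℝ) (x : Fin n → ℝ) :
    urgent prio θ x ⊆ servable x := by
  intro j hj
  rw [mem_urgent] at hj
  simp only [servable, Finset.mem_filter, Finset.mem_univ, true_and]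
  rcases hj with h | h <;> linarith [h]

lemma prefers_of_urgent {prio : Fin n → ℝ} {θ : ℝ} {x : Fin n → ℝ} {i j : Fin n}
    (hi : i ∈ urgent prio θ x) (hj : j ∉ urgent prio θ x) (hj1 : j ∈ servable x) :
    Prefers prio x i j := by
  rw [mem_urgent] at hi hj
  simp only [servable, Finset.mem_filter, Finset.mem_univ, true_and] at hj1
  unfold Prefers
  grind

lemma card_selected_of_le {p : ℕ} {prio : Fin n → ℝ} {x : Fin n → ℝ}
    (h : p ≤ (servable x).card) : (selected p prio x).card = p := by
  classical
  refine Eq.trans ?_ (card_filter_rankIn_lt (prefers_irrefl prio x) (prefers_trans prio x)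
    (prefers_total prio x) h)
  congr 1
  ext j
  simp only [mem_selected, Finset.mem_filter]

lemma card_selected_of_urgent {p : ℕ} {prio : Fin n → ℝ} {θ : ℝ} {x : Fin n → ℝ}
    (h : p ≤ (urgent prio θ x).card) : (selected p prio x).card = p :=
  card_selected_of_le (h.trans (Finset.card_le_card (urgent_subset_servable prio θ x)))

/-- Every urgent cup is preferred to every servable cup that is not urgent, so urgent cups form an
initial segment of the order. -/
lemma selected_subset_urgent {p : ℕ} {prio : Fin n → ℝ} {θ : ℝ} {x : Fin n → ℝ}
    (h : p ≤ (urgent prio θ x).card) : selected p prio x ⊆ urgent prio θ x := by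
  classical
  intro j hj
  by_contra hju
  obtain ⟨hj1, hj2⟩ := mem_selected.1 hj
  apply absurd (lt_of_lt_of_le hj2 h)
  rw [not_lt]
  apply Finset.card_le_card
  intro i hi
  simp only [Finset.mem_filter]
  exact ⟨urgent_subset_servable _ _ _ hi, prefers_of_urgent hi hju hj1⟩

lemma urgent_subset_selected {p : ℕ} {prio : Fin n → ℝ} {θ : ℝ} {x : Fin n → ℝ}
    (h : (urgent prio θ x).card ≤ p) : urgent prio θ x ⊆ selected p prio x := by
  classical
  intro j hj
  have hj1 := urgent_subset_servable _ _ _ hj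
  refine mem_selected.2 ⟨hj1, lt_of_lt_of_le ?_ h⟩
  apply Finset.card_lt_card
  rw [Finset.ssubset_iff_of_subset]
  · exact ⟨j, hj, by simp [prefers_irrefl]⟩
  · intro i hi
    simp only [Finset.mem_filter] at hi
    by_contra hiu
    exact prefers_irrefl _ _ _ (prefers_trans _ _ _ _ _ hi.2 (prefers_of_urgent hj hiu hi.1))

/-- Among cups of fill at least `2`, the emptier takes the fullest ones. -/
lemma le_of_mem_selected {p : ℕ} {prio x : Fin n → ℝ} {i j : Fin n}
    (hi : i ∈ selected p prio x) (hi2 : 2 ≤ x i) (hj : j ∉ selected p prio x) : x j ≤ x i := by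
  by_contra hlt
  push Not at hlt
  have hP : Prefers prio x j i := by
    right; left
    exact ⟨by linarith, hi2, Or.inl hlt⟩
  have hjU : j ∈ servable x := by
    simp only [servable, Finset.mem_filter, Finset.mem_univ, true_and]
    linarith
  exact hj (mem_selected.2 ⟨hjU, (rankIn_lt (prefers_irrefl _ _) (prefers_trans _ _) hjU hP).trans
    (mem_selected.1 hi).2⟩)

end CupGame

/-! ### Backlog from tail size: a concave potential -/

namespace CupGame

/-- The mass at `x` of the measure of concavity of `cap p N`. -/
noncomputable def weight (p x : ℕ) : ℝ := 4 / (|(x : ℝ) - p| + 1)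

/-- A concave function of `k`: the upper bound on the excess water in `k` cups. -/
noncomputable def cap (p N k : ℕ) : ℝ :=
  ∑ x ∈ Finset.range (N + 1), weight p x * min (k : ℝ) x

lemma weight_nonneg (p x : ℕ) : 0 ≤ weight p x := by
  unfold weight
  positivity

lemma cap_nonneg (p N k : ℕ) : 0 ≤ cap p N k :=
  Finset.sum_nonneg fun x _ => mul_nonneg (weight_nonneg p x) (by positivity)

lemma cap_mono (p N : ℕ) {k l : ℕ} (h : k ≤ l) : cap p N k ≤ cap p N l := by
  refine Finset.sum_le_sum fun x _ => mul_le_mul_of_nonneg_left ?_ (weight_nonneg p x)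
  exact min_le_min_right _ (by exact_mod_cast h)

/-- The integral of a tent function against `4 / (i + 1)` is at least the product of its sides. -/
lemma mul_le_sum_tent (a b : ℕ) (ha : 1 ≤ a) (hab : a ≤ b) (h : ℕ → ℝ)
    (h1 : ∀ i, i ≤ b - a → (a : ℝ) * (a + i) ≤ h i)
    (h2 : ∀ i, b - a ≤ i → i ≤ b → (b : ℝ) * (b - i) ≤ h i) (h0 : ∀ i, 0 ≤ h i) :
    (a : ℝ) * b ≤ ∑ i ∈ Finset.range (b + 1), 4 / ((i : ℝ) + 1) * h i := by
  have ha' : (1 : ℝ) ≤ a := by exact_mod_cast ha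
  have hab' : (a : ℝ) ≤ b := by exact_mod_cast hab
  have hn : ∀ i : ℕ, 0 ≤ 4 / ((i : ℝ) + 1) * h i := fun i => mul_nonneg (by positivity) (h0 i)
  -- For a long side `b` the rising part suffices: each of its more than `b / 2` terms is at least
  -- `4 * a`. Otherwise the falling part does, with every weight bounded below by `4 / (b + 1)`.
  by_cases hc : 2 * a ≤ b
  · have hc' : (2 : ℝ) * a ≤ b := by exact_mod_cast hc
    calc (a : ℝ) * b ≤ ∑ i ∈ Finset.range (b - a + 1), 4 * (a : ℝ) := by
          rw [Finset.sum_const, Finset.card_range, nsmul_eq_mul]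
          push_cast [Nat.cast_sub hab]
          nlinarith
      _ ≤ ∑ i ∈ Finset.range (b - a + 1), 4 / ((i : ℝ) + 1) * h i := by
          refine Finset.sum_le_sum fun i hi => ?_
          have := h1 i (by simp at hi; omega)
          rw [div_mul_eq_mul_div, le_div_iff₀ (by positivity)]
          have hi0 : (0 : ℝ) ≤ i := by positivity
          nlinarith
      _ ≤ _ := Finset.sum_le_sum_of_subset_of_nonneg
          (Finset.range_subset_range.2 (by omega)) fun i _ _ => hn i
  · push Not at hc
    have hc' : (b : ℝ) + 1 ≤ 2 * a := by exact_mod_cast hc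
    have hinj : Set.InjOn (fun j => b - j) (Finset.range (a + 1) : Set ℕ) := by
      intro i hi j hj hij
      simp at hi hj hij
      omega
    have hsub : (Finset.range (a + 1)).image (fun j => b - j) ⊆ Finset.range (b + 1) := by
      intro x hx
      simp at hx ⊢
      omega
    have hgauss : ∑ j ∈ Finset.range (a + 1), (j : ℝ) = a * (a + 1) / 2 := by
      have := Finset.sum_range_id_mul_two (a + 1)
      have h' : ((∑ i ∈ Finset.range (a + 1), i : ℕ) : ℝ) * 2 = (a + 1) * a := by
        exact_mod_cast this
      push_cast at h'
      linarith
    calc (a : ℝ) * b ≤ 4 / ((b : ℝ) + 1) * b * (a * (a + 1) / 2) := by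
          rw [div_mul_eq_mul_div, div_mul_eq_mul_div, le_div_iff₀ (by positivity)]
          have : 0 ≤ (a : ℝ) * b := by positivity
          nlinarith
      _ = ∑ j ∈ Finset.range (a + 1), 4 / ((b : ℝ) + 1) * b * j := by
          rw [← Finset.mul_sum, hgauss]
      _ ≤ ∑ j ∈ Finset.range (a + 1), 4 / (((b - j : ℕ) : ℝ) + 1) * h (b - j) := by
          refine Finset.sum_le_sum fun j hj => ?_
          have hj' : j ≤ a := by simp at hj; omega
          have hjb : j ≤ b := hj'.trans hab
          have := h2 (b - j) (by omega) (by omega)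
          rw [Nat.cast_sub hjb] at this ⊢
          rw [mul_assoc]
          have hjb' : (j : ℝ) ≤ b := by exact_mod_cast hjb
          have hj0 : (0 : ℝ) ≤ j := by positivity
          refine mul_le_mul ?_ ?_ (by positivity) ?_
          · exact div_le_div_of_nonneg_left (by norm_num) (by linarith) (by linarith)
          · linarith
          · exact div_nonneg (by norm_num) (by linarith)
      _ = ∑ i ∈ (Finset.range (a + 1)).image (fun j => b - j), 4 / ((i : ℝ) + 1) * h i := by
          rw [Finset.sum_image hinj]
      _ ≤ _ := Finset.sum_le_sum_of_subset_of_nonneg hsub fun i _ _ => hn i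

/-- The strong concavity of `cap` at the point `q + s` of the interval from `q` to `q + r + s`. -/
lemma cap_concave (q r s N : ℕ) (hr : 1 ≤ r) (hs : 1 ≤ s) (hN : q + r + s ≤ N) :
    r * cap (q + r) N q + s * cap (q + r) N (q + r + s) + r * s ≤
      (r + s) * cap (q + r) N (q + s) := by
  have hr' : (1 : ℝ) ≤ r := by exact_mod_cast hr
  have hs' : (1 : ℝ) ≤ s := by exact_mod_cast hs
  -- `T` is the tent over the interval from `q` to `q + r + s`, with slopes `r` and `-s` and height
  -- `r * s` at `q + s`.
  set T : ℕ → ℝ := fun x => ((r : ℝ) + s) * min ((q + s : ℕ) : ℝ) x - r * min (q : ℝ) x -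
    s * min ((q + r + s : ℕ) : ℝ) x with hT
  have hT0 : ∀ x, 0 ≤ T x := by
    intro x
    simp only [hT]
    push_cast
    have hq : (0 : ℝ) ≤ q := by positivity
    rcases le_total (x : ℝ) q with h1 | h1
    · rw [min_eq_right (by linarith), min_eq_right h1, min_eq_right (by linarith)]
      linarith
    rcases le_total (x : ℝ) (q + s) with h2 | h2
    · rw [min_eq_right h2, min_eq_left h1, min_eq_right (by linarith)]
      nlinarith
    rcases le_total (x : ℝ) (q + r + s) with h3 | h3
    · rw [min_eq_left h2, min_eq_left h1, min_eq_right h3]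
      nlinarith
    · rw [min_eq_left h2, min_eq_left h1, min_eq_left h3]
      nlinarith
  have hTl : ∀ x : ℕ, q ≤ x → x ≤ q + s → T x = r * ((x : ℝ) - q) := by
    intro x h1 h2
    have h1' : (q : ℝ) ≤ x := by exact_mod_cast h1
    have h2' : (x : ℝ) ≤ q + s := by exact_mod_cast h2
    simp only [hT]
    push_cast
    rw [min_eq_right h2', min_eq_left h1', min_eq_right (by linarith)]
    ring
  have hTr : ∀ x : ℕ, q + s ≤ x → x ≤ q + r + s → T x = s * ((q : ℝ) + r + s - x) := by
    intro x h1 h2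
    have h1' : (q : ℝ) + s ≤ x := by exact_mod_cast h1
    have h2' : (x : ℝ) ≤ q + r + s := by exact_mod_cast h2
    simp only [hT]
    push_cast
    rw [min_eq_left h1', min_eq_left (by linarith), min_eq_right h2']
    ring
  have hsum : ((r : ℝ) + s) * cap (q + r) N (q + s) - r * cap (q + r) N q -
      s * cap (q + r) N (q + r + s) =
      ∑ x ∈ Finset.range (N + 1), weight (q + r) x * T x := by
    simp only [cap, Finset.mul_sum, ← Finset.sum_sub_distrib, hT]
    refine Finset.sum_congr rfl fun x _ => ?_
    ring
  have hnn : ∀ x, 0 ≤ weight (q + r) x * T x := fun x => mul_nonneg (weight_nonneg _ x) (hT0 x)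
  have hmain : (r : ℝ) * s ≤ ∑ x ∈ Finset.range (N + 1), weight (q + r) x * T x := by
    -- The weights are centred at `q + r`. The sum is taken from there towards the farther end of
    -- the interval, the side that contains the peak.
    rcases le_total r s with hrs | hrs
    · have key := mul_le_sum_tent r s hr hrs (fun i => if i ≤ s then T (q + r + i) else 0)
        (by
          intro i hi
          rw [if_pos (by omega), hTl _ (by omega) (by omega)]
          push_cast
          apply le_of_eq
          ring)
        (by
          intro i hi hi2
          rw [if_pos hi2, hTr _ (by omega) (by omega)]
          push_cast
          apply le_of_eq
          ring)
        (by
          intro i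
          split_ifs
          · exact hT0 _
          · exact le_rfl)
      refine key.trans ?_
      calc _ = ∑ i ∈ Finset.range (s + 1), weight (q + r) (q + r + i) * T (q + r + i) := by
            refine Finset.sum_congr rfl fun i hi => ?_
            rw [if_pos (by simp at hi; omega)]
            congr 1
            simp [weight]
        _ = ∑ x ∈ (Finset.range (s + 1)).image (fun i => q + r + i), weight (q + r) x * T x := by
            rw [Finset.sum_image]
            intro i _ j _ hij
            simpa using hij
        _ ≤ _ := by
            refine Finset.sum_le_sum_of_subset_of_nonneg ?_ fun x _ _ => hnn x
            intro x hx
            simp at hx ⊢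
            omega
    · have key := mul_le_sum_tent s r hs hrs (fun i => if i ≤ r then T (q + r - i) else 0)
        (by
          intro i hi
          rw [if_pos (by omega), hTr _ (by omega) (by omega), Nat.cast_sub (by omega)]
          push_cast
          apply le_of_eq
          ring)
        (by
          intro i hi hi2
          rw [if_pos hi2, hTl _ (by omega) (by omega), Nat.cast_sub (by omega)]
          push_cast
          apply le_of_eq
          ring)
        (by
          intro i
          split_ifs
          · exact hT0 _
          · exact le_rfl)
      rw [mul_comm]
      refine key.trans ?_
      calc _ = ∑ i ∈ Finset.range (r + 1), weight (q + r) (q + r - i) * T (q + r - i) := by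
            refine Finset.sum_congr rfl fun i hi => ?_
            have hir : i ≤ r := by simp at hi; omega
            rw [if_pos hir]
            congr 1
            simp only [weight]
            rw [Nat.cast_sub (by omega)]
            congr 2
            push_cast
            rw [sub_right_comm, sub_self, zero_sub, abs_neg, abs_of_nonneg (by positivity)]
        _ = ∑ x ∈ (Finset.range (r + 1)).image (fun i => q + r - i), weight (q + r) x * T x := by
            rw [Finset.sum_image]
            intro i hi j hj hij
            simp at hi hj hij
            omega
        _ ≤ _ := by
            refine Finset.sum_le_sum_of_subset_of_nonneg ?_ fun x _ _ => hnn x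
            intro x hx
            simp at hx ⊢
            omega
  linarith

lemma sum_one_div_le_one_add_log (m : ℕ) :
    ∑ i ∈ Finset.range m, 1 / ((i : ℝ) + 1) ≤ 1 + Real.log m := by
  have := harmonic_le_one_add_log m
  simp only [harmonic, Rat.cast_sum] at this
  refine le_trans (le_of_eq ?_) this
  refine Finset.sum_congr rfl fun i _ => ?_
  push_cast
  rw [one_div]

/-- The total weight consists of two harmonic sums, one on each side of `p`. Strong concavity is
needed only on intervals around `p`, which is what allows weights with a merely logarithmic sum. -/
lemma cap_one_le (p N : ℕ) (hp : p ≤ N) : cap p N 1 ≤ 8 * (1 + Real.log (N + 1)) := by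
  have h1 : cap p N 1 ≤ ∑ x ∈ Finset.range (N + 1), weight p x := by
    refine Finset.sum_le_sum fun x _ => ?_
    refine mul_le_of_le_one_right (weight_nonneg p x) ?_
    simp
  refine h1.trans ?_
  have hN : N + 1 = p + (N + 1 - p) := by omega
  have hle : ∀ m, m ≤ N + 1 → ∑ i ∈ Finset.range m, 1 / ((i : ℝ) + 1) ≤ 1 + Real.log (N + 1) := by
    intro m hm
    refine le_trans (Finset.sum_le_sum_of_subset_of_nonneg
      (Finset.range_subset_range.2 hm) fun i _ _ => by positivity) ?_
    simpa using sum_one_div_le_one_add_log (N + 1)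
  rw [hN, Finset.sum_range_add, ← Finset.sum_range_reflect]
  have hA : ∑ j ∈ Finset.range p, weight p (p - 1 - j) ≤
      4 * ∑ i ∈ Finset.range p, 1 / ((i : ℝ) + 1) := by
    rw [Finset.mul_sum]
    refine Finset.sum_le_sum fun i hi => ?_
    have hi' : i + 1 ≤ p := by simp at hi; omega
    have : p - 1 - i = p - (i + 1) := by omega
    rw [this, weight, Nat.cast_sub hi', mul_one_div]
    refine div_le_div_of_nonneg_left (by norm_num) (by positivity) ?_
    push_cast
    rw [sub_right_comm, sub_self, zero_sub, abs_neg, abs_of_nonneg (by positivity)]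
    linarith
  have hB : ∑ j ∈ Finset.range (N + 1 - p), weight p (p + j) =
      4 * ∑ i ∈ Finset.range (N + 1 - p), 1 / ((i : ℝ) + 1) := by
    rw [Finset.mul_sum]
    refine Finset.sum_congr rfl fun i hi => ?_
    simp [weight, div_eq_mul_inv]
  have := hle p (by omega)
  have := hle (N + 1 - p) (by omega)
  linarith

variable {n : ℕ}

lemma emptyStep_of_mem {p : ℕ} {prio x : Fin n → ℝ} {j : Fin n} (h : j ∈ selected p prio x) :
    emptyStep p prio x j = x j - 1 := by
  simp [emptyStep, h]

lemma emptyStep_of_notMem {p : ℕ} {prio x : Fin n → ℝ} {j : Fin n} (h : j ∉ selected p prio x) :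
    emptyStep p prio x j = x j := by
  simp [emptyStep, h]

lemma two_le_card_eq_tailSize (x : Fin n → ℝ) :
    (Finset.univ.filter fun j => 2 ≤ x j).card = tailSize x := by
  rw [tailSize, ← Set.ncard_coe_finset]
  congr 1
  ext j
  simp

/-- One step of the game preserves the bound `cap` on the excess water in every set of cups. -/
lemma sum_emptyStep_le_cap {p S : ℕ} {prio x f : Fin n → ℝ}
    (hf : ∀ j, 0 ≤ f j ∧ f j ≤ 1) (hsum : ∑ j, f j = p)
    (hx : ∀ A : Finset (Fin n), ∑ j ∈ A, (x j - 2) ≤ cap p (S + p) A.card)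
    (hS : tailSize (emptyStep p prio (fun j => x j + f j)) ≤ S) (A : Finset (Fin n)) :
    ∑ j ∈ A, (emptyStep p prio (fun j => x j + f j) j - 2) ≤ cap p (S + p) A.card := by
  classical
  set x' : Fin n → ℝ := fun j => x j + f j with hx'
  set y := emptyStep p prio x' with hy
  set E := selected p prio x' with hE
  -- it suffices to consider sets of cups in the tail
  suffices key : ∀ A : Finset (Fin n), (∀ j ∈ A, 2 < y j) →
      ∑ j ∈ A, (y j - 2) ≤ cap p (S + p) A.card by
    calc ∑ j ∈ A, (y j - 2) ≤ ∑ j ∈ A, if 2 < y j then y j - 2 else 0 := by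
          refine Finset.sum_le_sum fun j _ => ?_
          split_ifs with h <;> linarith
      _ = ∑ j ∈ A.filter fun j => 2 < y j, (y j - 2) := by rw [Finset.sum_filter]
      _ ≤ cap p (S + p) (A.filter fun j => 2 < y j).card :=
          key _ fun j hj => (Finset.mem_filter.1 hj).2
      _ ≤ _ := cap_mono _ _ (Finset.card_le_card (Finset.filter_subset _ _))
  clear A
  intro A hA
  have hyE : ∀ j ∈ E, y j = x j + f j - 1 := fun j hj => emptyStep_of_mem hj
  have hyN : ∀ j, j ∉ E → y j = x j + f j := fun j hj => emptyStep_of_notMem hj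
  have hdec : ∀ B : Finset (Fin n), B ⊆ E → ∑ j ∈ B, (y j - 2) ≤ cap p (S + p) B.card := by
    intro B hB
    refine le_trans (Finset.sum_le_sum fun j hj => ?_) (hx B)
    rw [hyE j (hB hj)]
    linarith [(hf j).2]
  by_cases hAE : A ⊆ E
  · exact hdec A hAE
  have hyx : ∀ j, y j ≤ x' j := by
    intro j
    by_cases h : j ∈ E
    · rw [hyE j h]; simp only [hx']; linarith
    · rw [hyN j h]
  -- The threshold exceeds every priority, so exactly the cups of fill at least `2` are urgent.
  set K := urgent prio (1 + ∑ i, |prio i|) x' with hK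
  have hKmem : ∀ j, j ∈ K ↔ 2 ≤ x' j := by
    intro j
    rw [hK, mem_urgent]
    constructor
    · rintro (h | ⟨_, h⟩)
      · exact h
      · have := Finset.single_le_sum (f := fun i => |prio i|) (fun i _ => abs_nonneg _)
          (Finset.mem_univ j)
        have := le_abs_self (prio j)
        beta_reduce at *
        linarith
    · exact Or.inl
  have hAK : A ⊆ K := fun j hj => (hKmem j).2 (by linarith [hA j hj, hyx j])
  have hcard : p ≤ K.card := by
    by_contra hlt
    exact hAE (hAK.trans (urgent_subset_selected (le_of_lt (not_le.1 hlt))))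
  have hEcard : E.card = p := card_selected_of_urgent hcard
  have hEK : E ⊆ K := selected_subset_urgent hcard
  have hunion : ∑ j ∈ A ∪ E, (y j - 2) ≤ cap p (S + p) (A ∪ E).card := by
    refine le_trans ?_ (hx (A ∪ E))
    have h1 : ∑ j ∈ A ∪ E, (y j - 2) =
        ∑ j ∈ A ∪ E, (x j - 2) + ∑ j ∈ A ∪ E, f j - ∑ j ∈ A ∪ E, if j ∈ E then (1 : ℝ) else 0 := by
      rw [← Finset.sum_add_distrib, ← Finset.sum_sub_distrib]
      refine Finset.sum_congr rfl fun j _ => ?_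
      split_ifs with h
      · rw [hyE j h]; ring
      · rw [hyN j h]; ring
    have h2 : ∑ j ∈ A ∪ E, (if j ∈ E then (1 : ℝ) else 0) = p := by
      rw [← Finset.sum_filter, Finset.filter_mem_eq_inter, Finset.union_inter_cancel_right]
      simp [hEcard]
    have h3 : ∑ j ∈ A ∪ E, f j ≤ p := by
      rw [← hsum]
      exact Finset.sum_le_sum_of_subset_of_nonneg (Finset.subset_univ _) fun j _ _ => (hf j).1
    linarith
  by_cases hEA : E ⊆ A
  · rwa [Finset.union_eq_left.2 hEA] at hunion
  have hne : (E \ A).Nonempty := Finset.sdiff_nonempty.2 hEA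
  have hne' : (A \ E).Nonempty := Finset.sdiff_nonempty.2 hAE
  obtain ⟨i₀, hi₀, hmin⟩ := Finset.exists_min_image (E \ A) x' hne
  -- The excess `v` separates the two sides: cups of `A \ E` have excess at most `v`, and cups of `E
  -- \ A` keep at least `v - 1`. Comparing `A` with `A ∩ E` and with `A ∪ E` gives two bounds in
  -- which `v` has opposite signs.
  set v := x' i₀ - 2 with hv
  have hi₀E : i₀ ∈ E := (Finset.mem_sdiff.1 hi₀).1
  set q := (A ∩ E).card with hq
  set s := (A \ E).card with hs
  set r := (E \ A).card with hr
  have hr1 : 1 ≤ r := Finset.card_pos.2 hne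
  have hs1 : 1 ≤ s := Finset.card_pos.2 hne'
  have hpq : p = q + r := by
    rw [← hEcard, hq, hr, Finset.inter_comm]
    exact (Finset.card_inter_add_card_sdiff E A).symm
  have hAc : A.card = q + s := (Finset.card_inter_add_card_sdiff A E).symm
  have hUc : (A ∪ E).card = q + r + s := by
    have : (A ∪ E).card = (E \ A).card + A.card := by
      rw [Finset.union_comm, ← Finset.card_sdiff_add_card]
    omega
  have hAS : A.card ≤ S := by
    refine le_trans ?_ hS
    rw [← two_le_card_eq_tailSize]
    refine Finset.card_le_card fun j hj => ?_
    simp only [Finset.mem_filter, Finset.mem_univ, true_and]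
    exact (hA j hj).le
  have e1 : ∑ j ∈ A, (y j - 2) = ∑ j ∈ A ∩ E, (y j - 2) + ∑ j ∈ A \ E, (y j - 2) :=
    (Finset.sum_inter_add_sum_sdiff A E _).symm
  have e2 : ∑ j ∈ A ∪ E, (y j - 2) = ∑ j ∈ E \ A, (y j - 2) + ∑ j ∈ A, (y j - 2) := by
    rw [Finset.union_comm, ← Finset.sdiff_union_self_eq_union,
      Finset.sum_union Finset.sdiff_disjoint]
  have e3 : ∑ j ∈ A ∩ E, (y j - 2) ≤ cap p (S + p) q := hdec _ Finset.inter_subset_right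
  have e4 : ∑ j ∈ A \ E, (y j - 2) ≤ s * v := by
    rw [hs, ← nsmul_eq_mul]
    refine Finset.sum_le_card_nsmul _ _ _ fun j hj => ?_
    obtain ⟨hjA, hjE⟩ := Finset.mem_sdiff.1 hj
    have := le_of_mem_selected hi₀E ((hKmem _).1 (hEK hi₀E)) hjE
    have h2 := hyx j
    linarith
  have e5 : r * (v - 1) ≤ ∑ j ∈ E \ A, (y j - 2) := by
    rw [hr, ← nsmul_eq_mul]
    refine Finset.card_nsmul_le_sum _ _ _ fun j hj => ?_
    have h2 := hmin j hj
    rw [hyE j (Finset.mem_sdiff.1 hj).1]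
    simp only [hx'] at h2 hv
    linarith
  have hcon := cap_concave q r s (S + p) hr1 hs1 (by omega)
  rw [← hpq] at hcon
  rw [hUc, ← hpq] at hunion
  rw [hAc]
  have hr' : (1 : ℝ) ≤ r := by exact_mod_cast hr1
  have hs' : (1 : ℝ) ≤ s := by exact_mod_cast hs1
  have f1 : ∑ j ∈ A, (y j - 2) ≤ cap p (S + p) q + s * v := by linarith
  -- Weighting the two bounds by `r` and `s` cancels `v` and leaves the term `r * s` that
  -- `cap_concave` absorbs.
  have f2 : ∑ j ∈ A, (y j - 2) ≤ cap p (S + p) (p + s) - r * (v - 1) := by linarith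
  have f3 : ((r : ℝ) + s) * ∑ j ∈ A, (y j - 2) ≤ (r + s) * cap p (S + p) (q + s) := by
    have g1 := mul_le_mul_of_nonneg_left f1 (by linarith : (0 : ℝ) ≤ r)
    have g2 := mul_le_mul_of_nonneg_left f2 (by linarith : (0 : ℝ) ≤ s)
    nlinarith
  exact le_of_mul_le_mul_left f3 (by linarith)

/-- If the tail size never exceeds `S`, then the backlog never exceeds `O(log (S + p))`. -/
theorem fill_le_of_tailSize_le {p T S : ℕ} {F : ℕ → Fin n → ℝ} {r prio : Fin n → ℝ}
    (hF : IsFilling p T F) (hr : ∀ j, r j < 1)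
    (hS : ∀ t ≤ T, tailSize (fill p F r prio t) ≤ S) {t : ℕ} (ht : t ≤ T) (j : Fin n) :
    fill p F r prio t j ≤ 10 + 8 * Real.log (S + p + 1) := by
  have key : ∀ t ≤ T, ∀ A : Finset (Fin n),
      ∑ j ∈ A, (fill p F r prio t j - 2) ≤ cap p (S + p) A.card := by
    intro t
    induction t with
    | zero =>
      intro _ A
      refine le_trans (Finset.sum_nonpos fun j _ => ?_) (cap_nonneg _ _ _)
      have := hr j
      simp only [fill]
      linarith
    | succ t ih =>
      intro ht A
      exact sum_emptyStep_le_cap (hF t (by omega)).1 (hF t (by omega)).2 (ih (by omega))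
        (hS (t + 1) ht) A
  have h1 := key t ht {j}
  have h2 := cap_one_le p (S + p) (by omega)
  simp only [Finset.sum_singleton, Finset.card_singleton] at h1
  push_cast at h2
  linarith

end CupGame

/-! ### Tail size from backlog: tokens, busy windows and the recursion over priority levels -/

namespace CupGame

/-- The number of integers that are crossed when the fill level of a cup with offset `r` rises from
`r + u` to `r + v`. -/
noncomputable def crossings (u v r : ℝ) : ℤ := ⌊r + v⌋ - ⌊r + u⌋

lemma crossings_nonneg {u v : ℝ} (h : u ≤ v) (r : ℝ) : 0 ≤ crossings u v r := by
  have := Int.floor_mono (show r + u ≤ r + v by linarith)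
  simp only [crossings]
  omega

lemma crossings_self (u r : ℝ) : crossings u u r = 0 := by simp [crossings]

lemma crossings_add (u v w r : ℝ) : crossings u v r + crossings v w r = crossings u w r := by
  simp only [crossings]
  ring

lemma crossings_le (u v r : ℝ) : (crossings u v r : ℝ) ≤ v - u + 1 := by
  simp only [crossings]
  push_cast
  linarith [Int.floor_le (r + v), Int.lt_floor_add_one (r + u)]

variable {n : ℕ}

/-- The amount poured into cup `j` in the first `t` steps. -/
noncomputable def poured (F : ℕ → Fin n → ℝ) (t : ℕ) (j : Fin n) : ℝ := ∑ s ∈ Finset.range t, F s j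

lemma poured_succ (F : ℕ → Fin n → ℝ) (t : ℕ) (j : Fin n) :
    poured F (t + 1) j = poured F t j + F t j := by
  simp [poured, Finset.sum_range_succ]

lemma poured_mono {p T : ℕ} {F : ℕ → Fin n → ℝ} (hF : IsFilling p T F) {a b : ℕ} (hab : a ≤ b)
    (hb : b ≤ T) (j : Fin n) : poured F a j ≤ poured F b j := by
  refine Finset.sum_le_sum_of_subset_of_nonneg (Finset.range_subset_range.2 hab) fun s hs _ => ?_
  exact ((hF s (by simp at hs; omega)).1 j).1

lemma sum_poured {p T : ℕ} {F : ℕ → Fin n → ℝ} (hF : IsFilling p T F) {t : ℕ} (ht : t ≤ T) :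
    ∑ j, poured F t j = p * t := by
  simp only [poured]
  rw [Finset.sum_comm, Finset.sum_congr rfl fun s hs => (hF s (by simp at hs; omega)).2]
  simp [mul_comm]

/-- The number of units of water in a cup that count towards the level `θ`: all whole units for a
cup of priority at least `θ`, all whole units but one for the others. -/
noncomputable def tokens (θ prio x : ℝ) : ℤ := if θ ≤ prio then ⌊x⌋ else max (⌊x⌋ - 1) 0

lemma tokens_nonneg {x : ℝ} (hx : 0 ≤ x) (θ prio : ℝ) : 0 ≤ tokens θ prio x := by
  unfold tokens
  have := Int.floor_nonneg.2 hx
  split_ifs <;> omega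

lemma tokens_le {x : ℝ} (hx : 0 ≤ x) (θ prio : ℝ) : (tokens θ prio x : ℝ) ≤ x := by
  unfold tokens
  split_ifs
  · exact Int.floor_le x
  · push_cast
    exact max_le (by linarith [Int.floor_le x]) hx

lemma fill_succ (p : ℕ) (F : ℕ → Fin n → ℝ) (r prio : Fin n → ℝ) (t : ℕ) :
    fill p F r prio (t + 1) = emptyStep p prio (fun j => fill p F r prio t j + F t j) := rfl

lemma fill_nonneg {p T : ℕ} {F : ℕ → Fin n → ℝ} {r prio : Fin n → ℝ} (hF : IsFilling p T F)
    (hr : ∀ j, 0 ≤ r j) {t : ℕ} (ht : t ≤ T) (j : Fin n) : 0 ≤ fill p F r prio t j := by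
  induction t with
  | zero => exact hr j
  | succ t ih =>
    have := ih (by omega)
    have := ((hF t (by omega)).1 j).1
    rw [fill_succ]
    by_cases h : j ∈ selected p prio (fun j => fill p F r prio t j + F t j)
    · rw [emptyStep_of_mem h]
      have := one_le_of_mem_selected h
      linarith
    · rw [emptyStep_of_notMem h]
      linarith

/-- The emptier removes whole units only. This makes the crossings independent of its decisions. -/
lemma fill_eq_sub_int (p : ℕ) (F : ℕ → Fin n → ℝ) (r prio : Fin n → ℝ) (t : ℕ) (j : Fin n) :
    ∃ k : ℤ, fill p F r prio t j = r j + poured F t j - k := by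
  induction t with
  | zero => exact ⟨0, by simp [fill, poured]⟩
  | succ t ih =>
    obtain ⟨k, hk⟩ := ih
    rw [fill_succ]
    by_cases h : j ∈ selected p prio (fun j => fill p F r prio t j + F t j)
    · refine ⟨k + 1, ?_⟩
      rw [emptyStep_of_mem h, poured_succ, hk]
      push_cast
      ring
    · refine ⟨k, ?_⟩
      rw [emptyStep_of_notMem h, poured_succ, hk]
      ring

lemma floor_fill_add (p : ℕ) (F : ℕ → Fin n → ℝ) (r prio : Fin n → ℝ) (t : ℕ) (j : Fin n) :
    ⌊fill p F r prio t j + F t j⌋ =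
      ⌊fill p F r prio t j⌋ + crossings (poured F t j) (poured F (t + 1) j) (r j) := by
  obtain ⟨k, hk⟩ := fill_eq_sub_int p F r prio t j
  have h : fill p F r prio t j + F t j = r j + poured F (t + 1) j - k := by
    rw [hk, poured_succ]
    ring
  rw [h, hk, Int.floor_sub_intCast, Int.floor_sub_intCast]
  simp only [crossings]
  ring

/-- In the window from `a` to `b`, the level `θ` loses one token at the low-priority cups that were
below `1` and rise to `1`. -/
noncomputable def loss (θ : ℝ) (prio x : ℝ) (N : ℤ) : ℤ :=
  if prio < θ ∧ ⌊x⌋ < 1 ∧ 1 ≤ N then 1 else 0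

/-- The token balance of a window in which the emptier serves `p` urgent cups in every step. -/
lemma sum_tokens_window {p T : ℕ} {F : ℕ → Fin n → ℝ} {r prio : Fin n → ℝ} {θ : ℝ}
    (hF : IsFilling p T F) (hr : ∀ j, 0 ≤ r j) {a b : ℕ} (hab : a ≤ b) (hb : b ≤ T)
    (hbusy : ∀ t, a ≤ t → t < b →
      p ≤ (urgent prio θ (fun j => fill p F r prio t j + F t j)).card) :
    ∑ j, tokens θ (prio j) (fill p F r prio b j) + p * ((b : ℤ) - a) +
      ∑ j, loss θ (prio j) (fill p F r prio a j) (crossings (poured F a j) (poured F b j) (r j)) =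
    ∑ j, tokens θ (prio j) (fill p F r prio a j) +
      ∑ j, crossings (poured F a j) (poured F b j) (r j) := by
  classical
  -- `R j` counts the removals from cup `j`. The second invariant says that a low-priority cup, once
  -- at `1`, stays there, since in a busy step it is emptied only from fill at least `2`; hence it
  -- incurs the loss at most once.
  suffices key : ∃ R : Fin n → ℤ, ∑ j, R j = p * ((b : ℤ) - a) ∧ ∀ j,
      (tokens θ (prio j) (fill p F r prio b j) + R j +
        loss θ (prio j) (fill p F r prio a j) (crossings (poured F a j) (poured F b j) (r j)) =
        tokens θ (prio j) (fill p F r prio a j) + crossings (poured F a j) (poured F b j) (r j)) ∧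
      (prio j < θ → (1 ≤ ⌊fill p F r prio b j⌋ ↔ 1 ≤ ⌊fill p F r prio a j⌋ ∨
        1 ≤ crossings (poured F a j) (poured F b j) (r j))) by
    obtain ⟨R, hR, h⟩ := key
    rw [← hR, ← Finset.sum_add_distrib, ← Finset.sum_add_distrib, ← Finset.sum_add_distrib]
    exact Finset.sum_congr rfl fun j _ => (h j).1
  induction b, hab using Nat.le_induction with
  | base =>
    refine ⟨0, by simp, fun j => ⟨?_, fun _ => ?_⟩⟩ <;> simp [crossings_self, loss]
  | succ b hab ih =>
    obtain ⟨R, hR, h⟩ := ih (by omega) fun t h1 h2 => hbusy t h1 (by omega)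
    have hcard := hbusy b hab (by omega)
    set x' : Fin n → ℝ := fun j => fill p F r prio b j + F b j with hx'
    refine ⟨fun j => R j + if j ∈ selected p prio x' then 1 else 0, ?_, fun j => ?_⟩
    · rw [Finset.sum_add_distrib, hR, Finset.sum_boole]
      have : (Finset.univ.filter fun j => j ∈ selected p prio x') = selected p prio x' := by
        ext j; simp
      rw [this, card_selected_of_urgent hcard]
      push_cast
      ring
    · obtain ⟨h1, h2⟩ := h j
      have hfl := floor_fill_add p F r prio b j
      have hN := crossings_add (poured F a j) (poured F b j) (poured F (b + 1) j) (r j)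
      have hN0 := crossings_nonneg (poured_mono hF (Nat.le_succ b) hb j) (r j)
      have hN1 := crossings_nonneg (poured_mono hF hab (by omega) j) (r j)
      have hfa := Int.floor_nonneg.2
        (fill_nonneg (p := p) (prio := prio) hF hr (show a ≤ T by omega) j)
      have hfb := Int.floor_nonneg.2
        (fill_nonneg (p := p) (prio := prio) hF hr (show b ≤ T by omega) j)
      rw [fill_succ]
      generalize crossings (poured F a j) (poured F b j) (r j) = N at *
      generalize crossings (poured F b j) (poured F (b + 1) j) (r j) = N' at *
      rw [← hN]
      by_cases hs : j ∈ selected p prio x'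
      · have hu := mem_urgent.1 (selected_subset_urgent hcard hs)
        beta_reduce
        rw [emptyStep_of_mem hs, Int.floor_sub_one, if_pos hs]
        have hu' : 2 ≤ ⌊x' j⌋ ∨ (1 ≤ ⌊x' j⌋ ∧ θ ≤ prio j) := by
          rcases hu with hu | hu
          · exact Or.inl (Int.le_floor.2 (by exact_mod_cast hu))
          · exact Or.inr ⟨Int.le_floor.2 (by exact_mod_cast hu.1), hu.2⟩
        simp only [hx', hfl] at hu' ⊢
        simp only [tokens, Int.floor_sub_one, hfl, loss] at h1 h2 ⊢
        by_cases hθ : θ ≤ prio j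
        · have : ¬ prio j < θ := not_lt.2 hθ
          simp only [hθ, if_true, this, false_and, if_false, false_imp_iff, and_true] at *
          omega
        · have hθ' : prio j < θ := not_le.1 hθ
          simp only [hθ, if_false, hθ', true_and, and_false, or_false, true_imp_iff] at *
          split_ifs at * <;> omega
      · rw [emptyStep_of_notMem hs]
        simp only [hx'] at hs ⊢
        simp only [tokens, hfl, loss, hs, if_false] at h1 h2 ⊢
        by_cases hθ : θ ≤ prio j
        · have : ¬ prio j < θ := not_lt.2 hθ
          simp only [hθ, if_true, this, false_and, if_false, false_imp_iff, and_true] at *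
          omega
        · have hθ' : prio j < θ := not_le.1 hθ
          simp only [hθ, if_false, hθ', true_and, true_imp_iff] at *
          split_ifs at * <;> omega

/-- The total number of tokens of level `θ` after `t` steps. -/
noncomputable def tokenSum (p : ℕ) (F : ℕ → Fin n → ℝ) (r prio : Fin n → ℝ) (θ : ℝ) (t : ℕ) : ℝ :=
  ∑ j, (tokens θ (prio j) (fill p F r prio t j) : ℝ)

lemma tokenSum_nonneg {p T : ℕ} {F : ℕ → Fin n → ℝ} {r prio : Fin n → ℝ} (hF : IsFilling p T F)
    (hr : ∀ j, 0 ≤ r j) (θ : ℝ) {t : ℕ} (ht : t ≤ T) : 0 ≤ tokenSum p F r prio θ t :=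
  Finset.sum_nonneg fun j _ => by exact_mod_cast tokens_nonneg (fill_nonneg hF hr ht j) θ _

open Classical in
/-- The cups of priority in `[θ', θ)` whose level crosses an integer in the window from `a` to
`b`. -/
noncomputable def crossingCups (F : ℕ → Fin n → ℝ) (r prio : Fin n → ℝ) (θ' θ : ℝ) (a b : ℕ) :
    Finset (Fin n) :=
  {j | (θ' ≤ prio j ∧ prio j < θ) ∧ 1 ≤ crossings (poured F a j) (poured F b j) (r j)}

/-- The subtracted maximum bounds the loss from below: a crossing cup of the class either starts
below `1` and loses a token of level `θ`, or already holds a token of level `θ'` at time `a`. -/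
lemma tokenSum_le_of_window {p T : ℕ} {F : ℕ → Fin n → ℝ} {r prio : Fin n → ℝ} {θ : ℝ}
    (hF : IsFilling p T F) (hr : ∀ j, 0 ≤ r j) {a b : ℕ} (hab : a ≤ b) (hb : b ≤ T)
    (hbusy : ∀ t, a ≤ t → t < b →
      p ≤ (urgent prio θ (fun j => fill p F r prio t j + F t j)).card) (θ' : ℝ) :
    tokenSum p F r prio θ b ≤ tokenSum p F r prio θ a +
      (∑ j, (crossings (poured F a j) (poured F b j) (r j) : ℝ) - p * ((b : ℝ) - a)) -
      max ((crossingCups F r prio θ' θ a b).card - tokenSum p F r prio θ' a) 0 := by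
  classical
  have hw := sum_tokens_window hF hr hab hb hbusy
  have hw' : tokenSum p F r prio θ b + p * ((b : ℝ) - a) + ∑ j, (loss θ (prio j)
      (fill p F r prio a j) (crossings (poured F a j) (poured F b j) (r j)) : ℝ) =
      tokenSum p F r prio θ a + ∑ j, (crossings (poured F a j) (poured F b j) (r j) : ℝ) := by
    unfold tokenSum
    exact_mod_cast hw
  have h0 : (0 : ℝ) ≤ ∑ j, (loss θ (prio j)
      (fill p F r prio a j) (crossings (poured F a j) (poured F b j) (r j)) : ℝ) := by
    refine Finset.sum_nonneg fun j _ => ?_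
    simp only [loss]
    split_ifs <;> simp
  have h1 : ((crossingCups F r prio θ' θ a b).card : ℝ) - tokenSum p F r prio θ' a ≤
      ∑ j, (loss θ (prio j)
      (fill p F r prio a j) (crossings (poured F a j) (poured F b j) (r j)) : ℝ) := by
    rw [crossingCups, Finset.card_filter, tokenSum]
    push_cast
    rw [← Finset.sum_sub_distrib]
    refine Finset.sum_le_sum fun j _ => ?_
    have hf := fill_nonneg (p := p) (prio := prio) hF hr (show a ≤ T by omega) j
    have ht0 : (0 : ℝ) ≤ (tokens θ' (prio j) (fill p F r prio a j) : ℝ) := by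
      exact_mod_cast tokens_nonneg hf θ' _
    simp only [loss]
    by_cases hc : (θ' ≤ prio j ∧ prio j < θ) ∧ 1 ≤ crossings (poured F a j) (poured F b j) (r j)
    · rw [if_pos hc]
      by_cases hl : ⌊fill p F r prio a j⌋ < 1
      · rw [if_pos ⟨hc.1.2, hl, hc.2⟩]
        push_cast
        linarith
      · rw [if_neg (fun h => hl h.2.1), tokens, if_pos hc.1.1]
        have : (1 : ℝ) ≤ (⌊fill p F r prio a j⌋ : ℝ) := by exact_mod_cast not_lt.1 hl
        push_cast
        linarith
    · rw [if_neg hc]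
      split_ifs <;> push_cast <;> linarith
  have := max_le h1 h0
  linarith

/-- After a step with fewer than `p` urgent cups, few tokens are left. -/
lemma tokenSum_succ_le_of_not_busy {p T : ℕ} {F : ℕ → Fin n → ℝ} {r prio : Fin n → ℝ} {θ β : ℝ}
    (hF : IsFilling p T F) (hr : ∀ j, 0 ≤ r j) {t : ℕ} (ht : t < T)
    (hbusy : (urgent prio θ (fun j => fill p F r prio t j + F t j)).card < p)
    (hβ : 0 ≤ β) (hfill : ∀ j, fill p F r prio (t + 1) j ≤ β) :
    tokenSum p F r prio θ (t + 1) ≤ p * β := by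
  classical
  set K := urgent prio θ (fun j => fill p F r prio t j + F t j) with hK
  have hle : ∀ j, (tokens θ (prio j) (fill p F r prio (t + 1) j) : ℝ) ≤ if j ∈ K then β else 0 := by
    intro j
    have h0 := fill_nonneg (p := p) (prio := prio) hF hr (show t + 1 ≤ T by omega) j
    split_ifs with hj
    · exact (tokens_le h0 _ _).trans (hfill j)
    · have hle : fill p F r prio (t + 1) j ≤ fill p F r prio t j + F t j := by
        rw [fill_succ]
        by_cases h : j ∈ selected p prio (fun j => fill p F r prio t j + F t j)
        · rw [emptyStep_of_mem h]; linarith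
        · rw [emptyStep_of_notMem h]
      rw [hK, mem_urgent] at hj
      push Not at hj
      have : tokens θ (prio j) (fill p F r prio (t + 1) j) ≤ 0 := by
        unfold tokens
        split_ifs with hθ
        · have : ¬ (1 ≤ fill p F r prio t j + F t j) := fun h => absurd hθ (not_le.2 (hj.2 h))
          have : ⌊fill p F r prio (t + 1) j⌋ < 1 := Int.floor_lt.2 (by push_cast; linarith)
          omega
        · have : ⌊fill p F r prio (t + 1) j⌋ < 2 := Int.floor_lt.2 (by push_cast; linarith [hj.1])
          omega
      exact_mod_cast this
  calc tokenSum p F r prio θ (t + 1) ≤ ∑ j, if j ∈ K then β else 0 :=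
        Finset.sum_le_sum fun j _ => hle j
    _ = K.card * β := by simp
    _ ≤ p * β := mul_le_mul_of_nonneg_right (by exact_mod_cast hbusy.le) hβ

/-- The time `a` comes right after the last step with fewer than `p` urgent cups, or is `0`, when
all fills are below `1` and there are no tokens. -/
lemma exists_busy_window {p T : ℕ} {F : ℕ → Fin n → ℝ} {r prio : Fin n → ℝ} {β : ℝ}
    (hF : IsFilling p T F) (hr : ∀ j, 0 ≤ r j ∧ r j < 1) (hβ : 0 ≤ β)
    (hfill : ∀ t ≤ T, ∀ j, fill p F r prio t j ≤ β) (θ : ℝ) {b : ℕ} (hb : b ≤ T) :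
    ∃ a ≤ b, tokenSum p F r prio θ a ≤ p * β ∧ ∀ t, a ≤ t → t < b →
      p ≤ (urgent prio θ (fun j => fill p F r prio t j + F t j)).card := by
  induction b with
  | zero =>
    refine ⟨0, le_rfl, ?_, fun t _ h => absurd h (by omega)⟩
    refine le_trans (Finset.sum_nonpos fun j _ => ?_) (by positivity)
    have : ⌊r j⌋ = 0 := Int.floor_eq_zero_iff.2 ⟨(hr j).1, (hr j).2⟩
    simp [tokens, fill, this]
  | succ b ih =>
    by_cases hbusy : p ≤ (urgent prio θ (fun j => fill p F r prio b j + F b j)).card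
    · obtain ⟨a, hab, ha, h⟩ := ih (by omega)
      refine ⟨a, by omega, ha, fun t h1 h2 => ?_⟩
      rcases Nat.lt_succ_iff_lt_or_eq.1 h2 with h3 | rfl
      · exact h t h1 h3
      · exact hbusy
    · exact ⟨b + 1, le_rfl, tokenSum_succ_le_of_not_busy hF (fun j => (hr j).1) (by omega)
        (not_le.1 hbusy) hβ (hfill _ hb), fun t h1 h2 => absurd h2 (by omega)⟩

/-- The expected number of cups that cross an integer level in the window from `a` to `b`. -/
noncomputable def active (F : ℕ → Fin n → ℝ) (a b : ℕ) : ℝ :=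
  ∑ j, min (poured F b j - poured F a j) 1

lemma active_nonneg {p T : ℕ} {F : ℕ → Fin n → ℝ} (hF : IsFilling p T F) {a b : ℕ} (hab : a ≤ b)
    (hb : b ≤ T) : 0 ≤ active F a b :=
  Finset.sum_nonneg fun j _ => le_min (by linarith [poured_mono hF hab hb j]) zero_le_one

/-- In the window from `a` to `b`, the crossings behave as expected up to the deviation `L`, in total
and in each of the `m` priority classes. -/
structure TypicalWindow (p m : ℕ) (L : ℝ) (F : ℕ → Fin n → ℝ) (r prio : Fin n → ℝ) (a b : ℕ) :
    Prop where
  sum_crossings_le : ∑ j, (crossings (poured F a j) (poured F b j) (r j) : ℝ) ≤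
    p * ((b : ℝ) - a) + (2 * √(L * active F a b) + 2 * L)
  le_card_crossingCups : ∀ i < m, active F a b / (2 * m) - L ≤
    (crossingCups F r prio (i / m) ((i + 1 : ℕ) / m) a b).card

/-- Fluctuation against drift, uniformly in the activity `M`. Up to `4 * m * (L + B)` the square
root itself is small; beyond that the drift is at least `M / (4 * m)` and absorbs it by the
inequality of arithmetic and geometric means. -/
lemma deviation_le {M L B m : ℝ} (hM : 0 ≤ M) (hL : 0 ≤ L) (hB : 0 ≤ B) (hm : 1 ≤ m) :
    2 * √(L * M) + 2 * L - max (M / (2 * m) - L - B) 0 ≤ 6 * (L * m) + √(16 * (L * m) * B) := by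
  have hLm : L ≤ L * m := le_mul_of_one_le_right hL hm
  by_cases hc : M ≤ 4 * m * (L + B)
  · have h1 : 2 * √(L * M) ≤ 4 * √(L * m * L + L * m * B) := by
      have : (4 : ℝ) * √(L * m * L + L * m * B) = 2 * √(4 * (L * m * L + L * m * B)) := by
        rw [Real.sqrt_mul (by norm_num), show (4 : ℝ) = 2 ^ 2 by norm_num,
          Real.sqrt_sq (by norm_num)]
        ring
      rw [this]
      refine mul_le_mul_of_nonneg_left (Real.sqrt_le_sqrt ?_) (by norm_num)
      calc L * M ≤ L * (4 * m * (L + B)) := mul_le_mul_of_nonneg_left hc hL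
        _ = _ := by ring
    have h2 : √(L * m * L + L * m * B) ≤ L * m + √(L * m * B) := by
      have hadd : √(L * m * L + L * m * B) ≤ √(L * m * L) + √(L * m * B) := by
        refine Real.sqrt_le_iff.2 ⟨by positivity, ?_⟩
        rw [add_sq, Real.sq_sqrt (by positivity), Real.sq_sqrt (by positivity)]
        have : 0 ≤ 2 * √(L * m * L) * √(L * m * B) := by positivity
        linarith
      refine hadd.trans (add_le_add_left ?_ _)
      refine (Real.sqrt_le_sqrt (?_ : L * m * L ≤ (L * m) ^ 2)).trans
        (Real.sqrt_sq (by positivity)).le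
      rw [pow_two]
      exact mul_le_mul_of_nonneg_left hLm (by positivity)
    have h3 : √(16 * (L * m) * B) = 4 * √(L * m * B) := by
      rw [mul_assoc, Real.sqrt_mul (by norm_num), show (16 : ℝ) = 4 ^ 2 by norm_num,
        Real.sqrt_sq (by norm_num)]
    have := le_max_right (M / (2 * m) - L - B) 0
    linarith
  · push Not at hc
    have h1 : 2 * √(L * M) ≤ 4 * (L * m) + M / (4 * m) := by
      have e : L * M = (4 * (L * m)) * (M / (4 * m)) := by field_simp
      rw [e, Real.sqrt_mul (by positivity)]
      have := two_mul_le_add_sq (√(4 * (L * m))) (√(M / (4 * m)))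
      rw [Real.sq_sqrt (by positivity), Real.sq_sqrt (by positivity)] at this
      linarith
    have h2 : L + B ≤ M / (4 * m) := by
      rw [le_div_iff₀ (by positivity)]
      linarith
    have h3 : M / (2 * m) = 2 * (M / (4 * m)) := by field_simp; norm_num
    have := le_max_left (M / (2 * m) - L - B) 0
    have := Real.sqrt_nonneg (16 * (L * m) * B)
    linarith

/-- If all windows are typical, then the number of tokens decreases doubly exponentially in the
level, until it is of the order of `p * β + L * m`. -/
theorem tokenSum_le {p m T : ℕ} {L β : ℝ} {F : ℕ → Fin n → ℝ} {r prio : Fin n → ℝ}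
    (hn : 1 ≤ n) (hF : IsFilling p T F) (hr : ∀ j, 0 ≤ r j ∧ r j < 1) (hL : 1 ≤ L) (hm : 1 ≤ m)
    (hβ : 0 ≤ β) (hfill : ∀ t ≤ T, ∀ j, fill p F r prio t j ≤ β)
    (hW : ∀ a b, a ≤ b → b ≤ T → TypicalWindow p m L F r prio a b) {i : ℕ} (hi : i ≤ m) {b : ℕ}
    (hb : b ≤ T) :
    tokenSum p F r prio (i / m) b ≤
      4 * (p * β + 16 * (L * m)) * Real.exp (Real.log n / 2 ^ i) := by
  have hm' : (1 : ℝ) ≤ m := by exact_mod_cast hm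
  have hn' : (1 : ℝ) ≤ n := by exact_mod_cast hn
  have hLm : 1 ≤ L * m := one_le_mul_of_one_le_of_one_le hL hm'
  have hpβ : 0 ≤ p * β := by positivity
  set Q := p * β + 16 * (L * m) with hQ
  have hQ1 : 1 ≤ Q := by linarith
  induction i generalizing b with
  | zero =>
    obtain ⟨a, hab, ha, hbusy⟩ := exists_busy_window hF hr hβ hfill ((0 : ℕ) / m : ℝ) hb
    have h1 := tokenSum_le_of_window hF (fun j => (hr j).1) hab hb hbusy 0
    have h2 := le_max_right (((crossingCups F r prio 0 ((0 : ℕ) / m : ℝ) a b).card : ℝ) -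
      tokenSum p F r prio 0 a) 0
    -- At level `0` rounding alone bounds the deviation: at most one extra crossing per cup.
    have h3 : ∑ j, (crossings (poured F a j) (poured F b j) (r j) : ℝ) ≤
        p * ((b : ℝ) - a) + n := by
      refine (Finset.sum_le_sum fun j _ => crossings_le _ _ _).trans (le_of_eq ?_)
      rw [Finset.sum_add_distrib, Finset.sum_sub_distrib, sum_poured hF hb,
        sum_poured hF (hab.trans hb)]
      simp
      ring
    rw [pow_zero, div_one, Real.exp_log (by linarith)]
    have h4 : p * β ≤ Q * n := le_trans (by linarith) (le_mul_of_one_le_right (by linarith) hn')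
    have h5 : (n : ℝ) ≤ Q * n := le_mul_of_one_le_left (by linarith) hQ1
    nlinarith
  | succ i ih =>
    obtain ⟨a, hab, ha, hbusy⟩ := exists_busy_window hF hr hβ hfill ((i + 1 : ℕ) / m : ℝ) hb
    have h1 := tokenSum_le_of_window hF (fun j => (hr j).1) hab hb hbusy (i / m)
    have h2 := ih (by omega) (hab.trans hb)
    have hX0 := tokenSum_nonneg (prio := prio) hF (fun j => (hr j).1) (i / m) (hab.trans hb)
    set B := tokenSum p F r prio (i / m) a
    have hW' := hW a b hab hb
    have h3 := hW'.sum_crossings_le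
    have h4 := hW'.le_card_crossingCups i (by omega)
    have h5 := deviation_le (active_nonneg hF hab hb) (by linarith : (0 : ℝ) ≤ L) hX0 hm'
    have h6 : max (active F a b / (2 * m) - L - B) 0 ≤
        max ((crossingCups F r prio (i / m) ((i + 1 : ℕ) / m) a b).card - B) 0 :=
      max_le_max_right _ (by linarith)
    set y := Real.exp (Real.log n / 2 ^ (i + 1)) with hy
    have hyy : Real.exp (Real.log n / 2 ^ i) = y ^ 2 := by
      rw [hy, ← Real.exp_nat_mul]
      congr 1
      rw [pow_succ]
      push_cast
      field_simp
    have hy1 : 1 ≤ y := Real.one_le_exp (by have := Real.log_nonneg hn'; positivity)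
    -- As `16 * (L * m) ≤ Q` and `B ≤ 4 * Q * y ^ 2`, the square root halves the exponent of `n`,
    -- and the prefactor `4` reproduces itself.
    have h7 : √(16 * (L * m) * B) ≤ 2 * Q * y := by
      rw [hyy] at h2
      refine Real.sqrt_le_iff.2 ⟨by positivity, ?_⟩
      calc 16 * (L * m) * B ≤ Q * (4 * Q * y ^ 2) :=
            mul_le_mul (by linarith) h2 hX0 (by linarith)
        _ = _ := by ring
    have : Q ≤ Q * y := le_mul_of_one_le_right (by linarith) hy1
    linarith

lemma tailSize_le_tokenSum {p T : ℕ} {F : ℕ → Fin n → ℝ} {r prio : Fin n → ℝ}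
    (hF : IsFilling p T F) (hr : ∀ j, 0 ≤ r j) (θ : ℝ) {t : ℕ} (ht : t ≤ T) :
    (tailSize (fill p F r prio t) : ℝ) ≤ tokenSum p F r prio θ t := by
  rw [← two_le_card_eq_tailSize, Finset.card_filter, tokenSum]
  push_cast
  refine Finset.sum_le_sum fun j _ => ?_
  have hf := fill_nonneg (p := p) (prio := prio) hF hr ht j
  split_ifs with h
  · have : (2 : ℤ) ≤ ⌊fill p F r prio t j⌋ := Int.le_floor.2 (by exact_mod_cast h)
    have : 1 ≤ tokens θ (prio j) (fill p F r prio t j) := by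
      unfold tokens
      split_ifs <;> omega
    exact_mod_cast this
  · exact_mod_cast tokens_nonneg hf θ _

end CupGame

/-! ### Concentration of the crossings and the union bound over windows -/

namespace CupGame

/-- The uniform distribution on `[0, 1)`. -/
noncomputable def uniformUnit : Measure ℝ := (volume : Measure ℝ).restrict (Set.Ico 0 1)

instance : IsProbabilityMeasure uniformUnit := ⟨by simp [uniformUnit]⟩

lemma uniformVec_eq_pi (n : ℕ) : uniformVec n = Measure.pi fun _ : Fin n => uniformUnit := rfl

instance (n : ℕ) : IsProbabilityMeasure (uniformVec n) := by
  rw [uniformVec_eq_pi]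
  infer_instance

variable {n : ℕ}

lemma ae_uniformVec_mem_Ico (n : ℕ) : ∀ᵐ r ∂uniformVec n, ∀ j, 0 ≤ r j ∧ r j < 1 := by
  rw [ae_all_iff]
  intro j
  have h : ∀ᵐ x ∂uniformUnit, 0 ≤ x ∧ x < 1 := by
    have := ae_restrict_mem (μ := volume) (measurableSet_Ico (a := (0 : ℝ)) (b := 1))
    exact this
  have hq : Measure.QuasiMeasurePreserving (Function.eval j) (uniformVec n) uniformUnit :=
    Measure.quasiMeasurePreserving_eval (fun _ : Fin n => uniformUnit) j
  exact hq.ae h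

lemma measurable_crossings (u v : ℝ) : Measurable (crossings u v) := by
  unfold crossings
  exact (Int.measurable_floor.comp (measurable_id.add_const v)).sub
    (Int.measurable_floor.comp (measurable_id.add_const u))

lemma measurable_crossings_real (u v : ℝ) : Measurable fun x => (crossings u v x : ℝ) :=
  (measurable_from_top (f := fun k : ℤ => (k : ℝ))).comp (measurable_crossings u v)

/-- Only two consecutive values occur, so up to a constant shift a crossing count is a Bernoulli
variable. -/
lemma crossings_bounds (u v x : ℝ) :
    ⌊v - u⌋ ≤ crossings u v x ∧ crossings u v x ≤ ⌊v - u⌋ + 1 := by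
  unfold crossings
  have h1 := Int.floor_le (x + v)
  have h2 := Int.lt_floor_add_one (x + v)
  have h3 := Int.floor_le (x + u)
  have h4 := Int.lt_floor_add_one (x + u)
  have h5 := Int.floor_le (v - u)
  have h6 := Int.lt_floor_add_one (v - u)
  constructor
  · have : ((⌊v - u⌋ : ℤ) : ℝ) < ((⌊x + v⌋ - ⌊x + u⌋ + 1 : ℤ) : ℝ) := by push_cast; linarith
    have := Int.cast_lt.1 this
    omega
  · have : ((⌊x + v⌋ - ⌊x + u⌋ : ℤ) : ℝ) < ((⌊v - u⌋ + 2 : ℤ) : ℝ) := by push_cast; linarith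
    have := Int.cast_lt.1 this
    omega

lemma integrable_of_bounded {Ω : Type*} [MeasurableSpace Ω] {μ : Measure Ω} [IsFiniteMeasure μ]
    {f : Ω → ℝ} (hf : Measurable f) (C : ℝ) (hC : ∀ x, |f x| ≤ C) : Integrable f μ :=
  Integrable.of_bound hf.aestronglyMeasurable C (Filter.Eventually.of_forall hC)

lemma integrable_crossings (u v : ℝ) :
    Integrable (fun x => (crossings u v x : ℝ)) uniformUnit := by
  refine integrable_of_bounded (measurable_crossings_real u v) (|(⌊v - u⌋ : ℝ)| + 1) fun x => ?_
  obtain ⟨h1, h2⟩ := crossings_bounds u v x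
  have h1' : ((⌊v - u⌋ : ℤ) : ℝ) ≤ crossings u v x := by exact_mod_cast h1
  have h2' : (crossings u v x : ℝ) ≤ ((⌊v - u⌋ : ℤ) : ℝ) + 1 := by exact_mod_cast h2
  have := neg_abs_le ((⌊v - u⌋ : ℤ) : ℝ)
  have := le_abs_self ((⌊v - u⌋ : ℤ) : ℝ)
  rw [abs_le]
  constructor <;> linarith

/-- The fractional part has period `1`, so shifting a full period does not change its integral. -/
lemma integral_fract_add (v : ℝ) :
    ∫ x, Int.fract (x + v) ∂uniformUnit = ∫ x in (0 : ℝ)..1, Int.fract x := by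
  rw [uniformUnit, integral_Ico_eq_integral_Ioc,
    ← intervalIntegral.integral_of_le zero_le_one,
    intervalIntegral.integral_comp_add_right (fun x => Int.fract x)]
  have hp : Function.Periodic (fun x : ℝ => Int.fract x) 1 := fun x => Int.fract_add_one x
  have := hp.intervalIntegral_add_eq v 0
  rw [zero_add] at this ⊢
  rw [add_comm 1 v, this]

/-- A cup with uniformly random offset crosses `v - u` integers in expectation. -/
lemma integral_crossings (u v : ℝ) : ∫ x, (crossings u v x : ℝ) ∂uniformUnit = v - u := by
  have hfr : ∀ w : ℝ, Integrable (fun x : ℝ => Int.fract (x + w)) uniformUnit := by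
    intro w
    refine integrable_of_bounded (measurable_fract.comp (measurable_id.add_const w)) 1 fun x => ?_
    rw [abs_of_nonneg (Int.fract_nonneg _)]
    exact (Int.fract_lt_one _).le
  have h : ∀ x : ℝ, (crossings u v x : ℝ) = (v - u) - (Int.fract (x + v) - Int.fract (x + u)) := by
    intro x
    simp only [crossings, Int.fract]
    push_cast
    ring
  simp only [h]
  have hd : Integrable (fun x : ℝ => Int.fract (x + v) - Int.fract (x + u)) uniformUnit :=
    (hfr v).sub (hfr u)
  rw [integral_sub (integrable_const _) hd, integral_sub (hfr v) (hfr u),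
    integral_fract_add, integral_fract_add]
  simp

/-- On a variable with values `0` and `1` the exponential is affine, so its integral follows from
the mean. -/
lemma exp_crossings_eq (u v t x : ℝ) : Real.exp (t * (crossings u v x - (v - u))) =
    Real.exp (-(t * Int.fract (v - u))) *
      (1 + (Real.exp t - 1) * (crossings u v x - ⌊v - u⌋)) := by
  obtain ⟨h1, h2⟩ := crossings_bounds u v x
  have hfr := Int.floor_add_fract (v - u)
  have hc : crossings u v x = ⌊v - u⌋ ∨ crossings u v x = ⌊v - u⌋ + 1 := by omega
  rcases hc with hc | hc <;> rw [hc]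
  · rw [sub_self, mul_zero, add_zero, mul_one]
    congr 1
    linear_combination t * hfr
  · push_cast
    rw [add_sub_cancel_left, mul_one, add_sub_cancel, ← Real.exp_add]
    congr 1
    linear_combination t * hfr

lemma integrable_mul_crossings_sub (u v c k : ℝ) :
    Integrable (fun x => c * ((crossings u v x : ℝ) - k)) uniformUnit :=
  ((integrable_crossings u v).sub (integrable_const k)).const_mul c

lemma integrable_exp_crossings (u v t : ℝ) :
    Integrable (fun x => Real.exp (t * (crossings u v x - (v - u)))) uniformUnit := by
  simp only [exp_crossings_eq]
  exact ((integrable_const _).add (integrable_mul_crossings_sub u v _ _)).const_mul _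

lemma integral_exp_crossings_le {u v t : ℝ} (huv : u ≤ v) (ht0 : 0 ≤ t) (ht1 : t ≤ 1) :
    ∫ x, Real.exp (t * (crossings u v x - (v - u))) ∂uniformUnit ≤
      Real.exp (t ^ 2 * min (v - u) 1) := by
  have hf0 := Int.fract_nonneg (v - u)
  have hf1 : Int.fract (v - u) ≤ min (v - u) 1 := by
    refine le_min ?_ (Int.fract_lt_one _).le
    have : (0 : ℝ) ≤ (⌊v - u⌋ : ℤ) := by exact_mod_cast Int.floor_nonneg.2 (sub_nonneg.2 huv)
    linarith [Int.floor_add_fract (v - u)]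
  have hI : ∫ x, (1 + (Real.exp t - 1) * ((crossings u v x : ℝ) - ⌊v - u⌋)) ∂uniformUnit =
      1 + (Real.exp t - 1) * Int.fract (v - u) := by
    rw [integral_add (integrable_const _) (integrable_mul_crossings_sub u v _ _), integral_const_mul,
      integral_sub (integrable_crossings u v) (integrable_const _), integral_crossings]
    simp
  simp only [exp_crossings_eq]
  rw [integral_const_mul, hI]
  have h1 : 1 + (Real.exp t - 1) * Int.fract (v - u) ≤
      Real.exp ((Real.exp t - 1) * Int.fract (v - u)) := by
    rw [add_comm]
    exact Real.add_one_le_exp _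
  have h2 : Real.exp t - 1 - t ≤ t ^ 2 :=
    (le_abs_self _).trans (Real.abs_exp_sub_one_sub_id_le (by rwa [abs_of_nonneg ht0]))
  calc _ ≤ Real.exp (-(t * Int.fract (v - u))) *
        Real.exp ((Real.exp t - 1) * Int.fract (v - u)) :=
        mul_le_mul_of_nonneg_left h1 (Real.exp_pos _).le
    _ = Real.exp ((Real.exp t - 1 - t) * Int.fract (v - u)) := by
        rw [← Real.exp_add]
        congr 1
        ring
    _ ≤ _ := Real.exp_le_exp.2 (mul_le_mul h2 hf1 hf0 (by positivity))

/-- The upper tail of the number of crossings. -/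
lemma uniformVec_sum_crossings_ge_le {u v : Fin n → ℝ} (huv : ∀ j, u j ≤ v j) {L : ℝ} (hL : 0 < L) :
    (uniformVec n).real {r | 2 * √(L * ∑ j, min (v j - u j) 1) + 2 * L ≤
      ∑ j, ((crossings (u j) (v j) (r j) : ℝ) - (v j - u j))} ≤ Real.exp (-L) := by
  set M := ∑ j, min (v j - u j) 1 with hM
  have hM0 : 0 ≤ M := Finset.sum_nonneg fun j _ => le_min (by linarith [huv j]) zero_le_one
  set D := 2 * √(L * M) + 2 * L with hD
  have key : ∀ t, 0 ≤ t → t ≤ 1 → (uniformVec n).real {r | D ≤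
      ∑ j, ((crossings (u j) (v j) (r j) : ℝ) - (v j - u j))} ≤
      Real.exp (-t * D + t ^ 2 * M) := by
    intro t ht0 ht1
    have hexp : (fun r : Fin n → ℝ => Real.exp
        (t * ∑ j, ((crossings (u j) (v j) (r j) : ℝ) - (v j - u j)))) =
        fun r => ∏ j, Real.exp (t * ((crossings (u j) (v j) (r j) : ℝ) - (v j - u j))) := by
      funext r
      rw [Finset.mul_sum, Real.exp_sum]
    have hint : Integrable (fun r : Fin n → ℝ => Real.exp
        (t * ∑ j, ((crossings (u j) (v j) (r j) : ℝ) - (v j - u j)))) (uniformVec n) := by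
      rw [hexp, uniformVec_eq_pi]
      exact Integrable.fintype_prod fun j => integrable_exp_crossings (u j) (v j) t
    refine (ProbabilityTheory.measure_ge_le_exp_mul_mgf D ht0 hint).trans ?_
    rw [Real.exp_add]
    refine mul_le_mul_of_nonneg_left ?_ (Real.exp_pos _).le
    rw [ProbabilityTheory.mgf, hexp, uniformVec_eq_pi, integral_fintype_prod_eq_prod
      (f := fun j x => Real.exp (t * ((crossings (u j) (v j) x : ℝ) - (v j - u j)))), hM,
      Finset.mul_sum, Real.exp_sum]
    exact Finset.prod_le_prod (fun j _ => integral_nonneg fun x => (Real.exp_pos _).le)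
      fun j _ => integral_exp_crossings_le (huv j) ht0 ht1
  -- The exponent `-t * D + t ^ 2 * M` is made at most `-L` by `t = 1` if `M ≤ L`, and by `t = √(L /
  -- M)`, which is then at most `1`, otherwise.
  rcases le_total M L with hML | hML
  · refine (key 1 zero_le_one le_rfl).trans (Real.exp_le_exp.2 ?_)
    have := Real.sqrt_nonneg (L * M)
    simp only [hD]
    linarith
  · have hMpos : 0 < M := hL.trans_le hML
    refine (key (√(L / M)) (Real.sqrt_nonneg _) ?_).trans (Real.exp_le_exp.2 ?_)
    · rw [Real.sqrt_le_one, div_le_one hMpos]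
      exact hML
    · have e1 : √(L / M) * √(L * M) = L := by
        rw [← Real.sqrt_mul (by positivity), show L / M * (L * M) = L ^ 2 by field_simp,
          Real.sqrt_sq hL.le]
      have e2 : √(L / M) ^ 2 * M = L := by
        rw [Real.sq_sqrt (by positivity)]
        field_simp
      have e3 : 0 ≤ √(L / M) * L := by positivity
      rw [e2, hD]
      nlinarith

/-- The indicator of a crossing. -/
noncomputable def crossed (u v x : ℝ) : ℝ := if 1 ≤ crossings u v x then 1 else 0

lemma measurable_crossed (u v : ℝ) : Measurable (crossed u v) := by
  unfold crossed
  exact Measurable.ite (measurable_crossings u v (MeasurableSet.of_discrete (s := Set.Ici 1)))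
    measurable_const measurable_const

/-- A rise by at least `1` crosses surely; a smaller rise crosses at most once, so the indicator
equals the crossing count. This is why `active` sums these minima. -/
lemma integral_crossed {u v : ℝ} (huv : u ≤ v) :
    ∫ x, crossed u v x ∂uniformUnit = min (v - u) 1 := by
  rcases le_or_gt 1 (v - u) with h | h
  · have : ∀ x, crossed u v x = 1 := by
      intro x
      have h1 : (1 : ℤ) ≤ ⌊v - u⌋ := Int.le_floor.2 (by exact_mod_cast h)
      rw [crossed, if_pos (h1.trans (crossings_bounds u v x).1)]
    simp [this, min_eq_right h]
  · have : ∀ x, crossed u v x = crossings u v x := by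
      intro x
      have h0 : ⌊v - u⌋ = 0 := Int.floor_eq_zero_iff.2 ⟨by linarith, h⟩
      have hb := crossings_bounds u v x
      rw [h0] at hb
      rw [crossed]
      split_ifs with h1
      · have : crossings u v x = 1 := by omega
        simp [this]
      · have : crossings u v x = 0 := by omega
        simp [this]
    simp only [this]
    rw [integral_crossings, min_eq_left h.le]

/-- The indicator of a class of priorities. -/
noncomputable def inClass (θ' θ x : ℝ) : ℝ := if θ' ≤ x ∧ x < θ then 1 else 0

lemma measurable_inClass (θ' θ : ℝ) : Measurable (inClass θ' θ) := by
  unfold inClass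
  exact Measurable.ite (measurableSet_Ico (a := θ') (b := θ)) measurable_const measurable_const

lemma integral_inClass {θ' θ : ℝ} (h0 : 0 ≤ θ') (h : θ' ≤ θ) (h1 : θ ≤ 1) :
    ∫ x, inClass θ' θ x ∂uniformUnit = θ - θ' := by
  have : inClass θ' θ = (Set.Ico θ' θ).indicator 1 := by
    funext x
    simp only [inClass, Set.indicator, Set.mem_Ico, Pi.one_apply]
  rw [this, integral_indicator_one measurableSet_Ico, uniformUnit, measureReal_restrict_apply
    measurableSet_Ico, Set.inter_eq_left.2 (Set.Ico_subset_Ico h0 h1), Real.volume_real_Ico_of_le h]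

lemma crossed_eq (u v x : ℝ) : crossed u v x = 0 ∨ crossed u v x = 1 := by
  unfold crossed
  split_ifs <;> simp

lemma inClass_eq (θ' θ x : ℝ) : inClass θ' θ x = 0 ∨ inClass θ' θ x = 1 := by
  unfold inClass
  split_ifs <;> simp

/-- The lower tail of the number of cups of a priority class that cross an integer. -/
lemma uniformVec_prod_crossed_le {u v : Fin n → ℝ} (huv : ∀ j, u j ≤ v j) {θ' θ L : ℝ}
    (h0 : 0 ≤ θ') (h : θ' ≤ θ) (h1 : θ ≤ 1) :
    ((uniformVec n).prod (uniformVec n)).real {s |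
      ∑ j, crossed (u j) (v j) (s.1 j) * inClass θ' θ (s.2 j) ≤
        (θ - θ') / 2 * ∑ j, min (v j - u j) 1 - L} ≤ Real.exp (-L) := by
  set M := ∑ j, min (v j - u j) 1 with hM
  have hM0 : 0 ≤ M := Finset.sum_nonneg fun j _ => le_min (by linarith [huv j]) zero_le_one
  set e : ℝ := 1 - Real.exp (-1) with he
  have hexp1 : Real.exp (-1) ≤ 1 / 2 := by
    rw [Real.exp_neg, one_div]
    exact inv_anti₀ (by norm_num) (by linarith [Real.add_one_le_exp 1])
  have hexp0 := Real.exp_pos (-1)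
  set X : (Fin n → ℝ) × (Fin n → ℝ) → ℝ := fun s =>
    -∑ j, crossed (u j) (v j) (s.1 j) * inClass θ' θ (s.2 j) with hX
  have hXmeas : Measurable X := by
    refine (Finset.measurable_fun_sum _ fun j _ => ?_).neg
    exact ((measurable_crossed _ _).comp ((measurable_pi_apply j).comp measurable_fst)).mul
      ((measurable_inClass _ _).comp ((measurable_pi_apply j).comp measurable_snd))
  have hX0 : ∀ s, X s ≤ 0 := by
    intro s
    refine neg_nonpos.2 (Finset.sum_nonneg fun j _ => ?_)
    rcases crossed_eq (u j) (v j) (s.1 j) with h | h <;>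
      rcases inClass_eq θ' θ (s.2 j) with h' | h' <;> simp [h, h']
  have hint : Integrable (fun s => Real.exp (1 * X s)) ((uniformVec n).prod (uniformVec n)) := by
    refine integrable_of_bounded (Real.measurable_exp.comp (hXmeas.const_mul 1)) 1 fun s => ?_
    rw [abs_of_pos (Real.exp_pos _), one_mul]
    exact Real.exp_le_one_iff.2 (hX0 s)
  have hIc : ∀ j, Integrable (crossed (u j) (v j)) uniformUnit := fun j =>
    integrable_of_bounded (measurable_crossed _ _) 1 fun x => by
      rcases crossed_eq (u j) (v j) x with h | h <;> simp [h]
  have hIb : Integrable (inClass θ' θ) uniformUnit :=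
    integrable_of_bounded (measurable_inClass _ _) 1 fun x => by
      rcases inClass_eq θ' θ x with h | h <;> simp [h]
  -- Chernoff's bound at parameter `1`: the priorities are integrated out with the offsets fixed,
  -- then the offsets. The factor `e = 1 - exp (-1)` is at least `1 / 2`, whence the halved mean.
  have hinner : ∀ r : Fin n → ℝ, ∫ q, Real.exp (1 * X (r, q)) ∂uniformVec n =
      ∏ j, (1 - e * (θ - θ') * crossed (u j) (v j) (r j)) := by
    intro r
    have e1 : ∀ q : Fin n → ℝ, Real.exp (1 * X (r, q)) =
        ∏ j, (1 - e * crossed (u j) (v j) (r j) * inClass θ' θ (q j)) := by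
      intro q
      rw [one_mul, hX]
      simp only
      rw [← Finset.sum_neg_distrib, Real.exp_sum]
      refine Finset.prod_congr rfl fun j _ => ?_
      rcases crossed_eq (u j) (v j) (r j) with h | h <;>
        rcases inClass_eq θ' θ (q j) with h' | h' <;> simp [h, h', he]
    simp only [e1]
    rw [uniformVec_eq_pi, integral_fintype_prod_eq_prod
      (f := fun j x => 1 - e * crossed (u j) (v j) (r j) * inClass θ' θ x)]
    refine Finset.prod_congr rfl fun j _ => ?_
    rw [integral_sub (integrable_const _) (hIb.const_mul _), integral_const_mul,
      integral_inClass h0 h h1]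
    simp
    ring
  have hmgf : ProbabilityTheory.mgf X ((uniformVec n).prod (uniformVec n)) 1 ≤
      Real.exp (-(e * (θ - θ') * M)) := by
    rw [ProbabilityTheory.mgf, integral_prod _ hint]
    simp only [hinner]
    rw [uniformVec_eq_pi, integral_fintype_prod_eq_prod
      (f := fun j x => 1 - e * (θ - θ') * crossed (u j) (v j) x), hM, Finset.mul_sum,
      ← Finset.sum_neg_distrib, Real.exp_sum]
    have hval : ∀ j, ∫ x, (1 - e * (θ - θ') * crossed (u j) (v j) x) ∂uniformUnit =
        1 - e * (θ - θ') * min (v j - u j) 1 := by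
      intro j
      rw [integral_sub (integrable_const _) ((hIc j).const_mul _), integral_const_mul,
        integral_crossed (huv j)]
      simp
    simp only [hval]
    refine Finset.prod_le_prod (fun j _ => ?_) fun j _ => ?_
    · have a1 : 0 ≤ min (v j - u j) 1 := le_min (by linarith [huv j]) zero_le_one
      have a2 : min (v j - u j) 1 ≤ 1 := min_le_right _ _
      have a3 : e * (θ - θ') ≤ 1 := mul_le_one₀ (by linarith) (by linarith) (by linarith)
      linarith [mul_le_one₀ a3 a1 a2]
    · linarith [Real.add_one_le_exp (-(e * (θ - θ') * min (v j - u j) 1))]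
  have hset : {s : (Fin n → ℝ) × (Fin n → ℝ) |
      ∑ j, crossed (u j) (v j) (s.1 j) * inClass θ' θ (s.2 j) ≤ (θ - θ') / 2 * M - L} =
      {s | -((θ - θ') / 2 * M - L) ≤ X s} := by
    ext s
    simp only [Set.mem_ofPred_eq, hX, neg_le_neg_iff]
  rw [hset]
  refine (ProbabilityTheory.measure_ge_le_exp_mul_mgf _ zero_le_one hint).trans ?_
  refine (mul_le_mul_of_nonneg_left hmgf (Real.exp_pos _).le).trans ?_
  rw [← Real.exp_add]
  refine Real.exp_le_exp.2 ?_
  have : 0 ≤ (e - 1 / 2) * ((θ - θ') * M) :=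
    mul_nonneg (by linarith) (mul_nonneg (by linarith) hM0)
  linarith

lemma card_crossingCups (F : ℕ → Fin n → ℝ) (r prio : Fin n → ℝ) (θ' θ : ℝ) (a b : ℕ) :
    ((crossingCups F r prio θ' θ a b).card : ℝ) =
      ∑ j, crossed (poured F a j) (poured F b j) (r j) * inClass θ' θ (prio j) := by
  classical
  rw [crossingCups, Finset.card_filter]
  push_cast
  refine Finset.sum_congr rfl fun j _ => ?_
  simp only [crossed, inClass]
  split_ifs <;> simp_all

/-- Against a fixed filler, a window is typical with high probability. -/
lemma prob_not_typicalWindow_le {p m T : ℕ} {L : ℝ} {F : ℕ → Fin n → ℝ} (hF : IsFilling p T F)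
    (hL : 0 < L) (hm : 1 ≤ m) {a b : ℕ} (hab : a ≤ b) (hb : b ≤ T) :
    ((uniformVec n).prod (uniformVec n)).real {s | ¬ TypicalWindow p m L F s.1 s.2 a b} ≤
      (m + 1) * Real.exp (-L) := by
  have hm' : (0 : ℝ) < m := by exact_mod_cast hm
  set μ := (uniformVec n).prod (uniformVec n) with hμ
  set A : Set (Fin n → ℝ) := {r | 2 * √(L * active F a b) + 2 * L ≤
    ∑ j, ((crossings (poured F a j) (poured F b j) (r j) : ℝ) - (poured F b j - poured F a j))}
  set B : ℕ → Set ((Fin n → ℝ) × (Fin n → ℝ)) := fun i => {s |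
    ∑ j, crossed (poured F a j) (poured F b j) (s.1 j) *
      inClass (i / m) ((i + 1 : ℕ) / m) (s.2 j) ≤
        (((i + 1 : ℕ) / m : ℝ) - i / m) / 2 * active F a b - L}
  have hmono := poured_mono hF hab hb
  have hsub : {s | ¬ TypicalWindow p m L F s.1 s.2 a b} ⊆
      Prod.fst ⁻¹' A ∪ ⋃ i ∈ Finset.range m, B i := by
    intro s hs
    by_contra hc
    simp only [Set.mem_union, Set.mem_preimage, Set.mem_iUnion, Finset.mem_range, not_or,
      not_exists] at hc
    refine hs ⟨?_, fun i hi => ?_⟩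
    · have := hc.1
      simp only [A, Set.mem_ofPred_eq, not_le] at this
      rw [Finset.sum_sub_distrib, Finset.sum_sub_distrib, sum_poured hF hb,
        sum_poured hF (hab.trans hb)] at this
      linarith
    · have := hc.2 i hi
      simp only [B, Set.mem_ofPred_eq, not_le] at this
      rw [card_crossingCups]
      refine le_trans (le_of_eq ?_) this.le
      push_cast
      field_simp
      ring
  have hA : μ.real (Prod.fst ⁻¹' A) ≤ Real.exp (-L) := by
    have hAm : MeasurableSet A := by
      refine measurableSet_le measurable_const (Finset.measurable_fun_sum _ fun j _ => ?_)
      exact ((measurable_crossings_real _ _).comp (measurable_pi_apply j)).sub_const _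
    have : μ.real (Prod.fst ⁻¹' A) = (uniformVec n).real A := by
      rw [hμ, measureReal_def, measurePreserving_fst.measure_preimage hAm.nullMeasurableSet,
        measureReal_def]
    rw [this]
    exact uniformVec_sum_crossings_ge_le hmono hL
  have hB : ∀ i ∈ Finset.range m, μ.real (B i) ≤ Real.exp (-L) := by
    intro i hi
    refine uniformVec_prod_crossed_le hmono (by positivity) ?_ ?_
    · gcongr
      omega
    · rw [div_le_one hm']
      exact_mod_cast Finset.mem_range.1 hi
  calc μ.real {s | ¬ TypicalWindow p m L F s.1 s.2 a b}
      ≤ μ.real (Prod.fst ⁻¹' A ∪ ⋃ i ∈ Finset.range m, B i) := measureReal_mono hsub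
    _ ≤ μ.real (Prod.fst ⁻¹' A) + μ.real (⋃ i ∈ Finset.range m, B i) := measureReal_union_le _ _
    _ ≤ Real.exp (-L) + ∑ i ∈ Finset.range m, μ.real (B i) :=
        add_le_add hA (measureReal_biUnion_finset_le _ _)
    _ ≤ Real.exp (-L) + ∑ i ∈ Finset.range m, Real.exp (-L) := by
        gcongr with i hi
        exact hB i hi
    _ = _ := by
        simp
        ring

variable {Ω : Type*} [MeasurableSpace Ω]

lemma measurable_poured {F : Ω → ℕ → Fin n → ℝ} (hF : ∀ t j, Measurable fun ω => F ω t j)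
    (t : ℕ) (j : Fin n) : Measurable fun ω => poured (F ω) t j :=
  Finset.measurable_fun_sum _ fun s _ => hF s j

lemma measurableSet_typicalWindow {F : Ω → ℕ → Fin n → ℝ}
    (hF : ∀ t j, Measurable fun ω => F ω t j) (p m : ℕ) (L : ℝ) (a b : ℕ) :
    MeasurableSet {s : Ω × (Fin n → ℝ) × (Fin n → ℝ) |
      TypicalWindow p m L (F s.1) s.2.1 s.2.2 a b} := by
  have hP : ∀ t j, Measurable fun s : Ω × (Fin n → ℝ) × (Fin n → ℝ) => poured (F s.1) t j :=
    fun t j => (measurable_poured hF t j).comp measurable_fst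
  have hr : ∀ j, Measurable fun s : Ω × (Fin n → ℝ) × (Fin n → ℝ) => s.2.1 j := fun j =>
    (measurable_pi_apply j).comp (measurable_fst.comp measurable_snd)
  have hq : ∀ j, Measurable fun s : Ω × (Fin n → ℝ) × (Fin n → ℝ) => s.2.2 j := fun j =>
    (measurable_pi_apply j).comp (measurable_snd.comp measurable_snd)
  have hN : ∀ j, Measurable fun s : Ω × (Fin n → ℝ) × (Fin n → ℝ) =>
      crossings (poured (F s.1) a j) (poured (F s.1) b j) (s.2.1 j) := fun j =>
    (Int.measurable_floor.comp ((hr j).add (hP b j))).sub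
      (Int.measurable_floor.comp ((hr j).add (hP a j)))
  have hM : Measurable fun s : Ω × (Fin n → ℝ) × (Fin n → ℝ) => active (F s.1) a b :=
    Finset.measurable_fun_sum _ fun j _ => ((hP b j).sub (hP a j)).min measurable_const
  have heq : {s : Ω × (Fin n → ℝ) × (Fin n → ℝ) | TypicalWindow p m L (F s.1) s.2.1 s.2.2 a b} =
      {s | ∑ j, (crossings (poured (F s.1) a j) (poured (F s.1) b j) (s.2.1 j) : ℝ) ≤
        p * ((b : ℝ) - a) + (2 * √(L * active (F s.1) a b) + 2 * L)} ∩
      ⋂ i ∈ Finset.range m, {s | active (F s.1) a b / (2 * m) - L ≤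
        ∑ j, crossed (poured (F s.1) a j) (poured (F s.1) b j) (s.2.1 j) *
          inClass (i / m) ((i + 1 : ℕ) / m) (s.2.2 j)} := by
    ext s
    simp only [Set.mem_inter_iff, Set.mem_ofPred_eq, Set.mem_iInter, Finset.mem_range,
      ← card_crossingCups]
    exact ⟨fun h => ⟨h.1, h.2⟩, fun h => ⟨h.1, h.2⟩⟩
  rw [heq]
  refine (measurableSet_le ?_ ?_).inter (Finset.measurableSet_biInter _ fun i _ =>
    measurableSet_le ?_ ?_)
  · exact Finset.measurable_fun_sum _ fun j _ =>
      (measurable_from_top (f := fun k : ℤ => (k : ℝ))).comp (hN j)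
  · exact ((((hM.const_mul L).sqrt).const_mul 2).add_const _).const_add _
  · exact (hM.div_const _).sub_const _
  · refine Finset.measurable_fun_sum _ fun j _ => ?_
    refine Measurable.mul ?_ ((measurable_inClass _ _).comp (hq j))
    exact Measurable.ite (hN j (MeasurableSet.of_discrete (s := Set.Ici 1)))
      measurable_const measurable_const

/-- With high probability, all offsets are in `[0, 1)` and all windows are typical. -/
theorem prob_typical_ge {p m T : ℕ} {L : ℝ} (ν : Measure Ω) [IsProbabilityMeasure ν]
    {F : Ω → ℕ → Fin n → ℝ} (hFm : ∀ t j, Measurable fun ω => F ω t j)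
    (hF : ∀ ω, IsFilling p T (F ω)) (hL : 0 < L) (hm : 1 ≤ m) :
    (ν.prod ((uniformVec n).prod (uniformVec n))).real {s | ¬ ((∀ j, 0 ≤ s.2.1 j ∧ s.2.1 j < 1) ∧
      ∀ a b, a ≤ b → b ≤ T → TypicalWindow p m L (F s.1) s.2.1 s.2.2 a b)} ≤
      (T + 1) ^ 2 * ((m + 1) * Real.exp (-L)) := by
  set μ := (uniformVec n).prod (uniformVec n) with hμ
  set P := ν.prod μ with hP
  have hnull : P.real {s | ¬ ∀ j, 0 ≤ s.2.1 j ∧ s.2.1 j < 1} = 0 := by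
    have hq : Measure.QuasiMeasurePreserving
        (fun s : Ω × (Fin n → ℝ) × (Fin n → ℝ) => s.2.1) P (uniformVec n) :=
      Measure.quasiMeasurePreserving_fst.comp Measure.quasiMeasurePreserving_snd
    have := hq.ae (ae_uniformVec_mem_Ico n)
    rw [measureReal_def, ae_iff.1 this, ENNReal.toReal_zero]
  have hwin : ∀ a b, a ≤ b → b ≤ T →
      P.real {s | ¬ TypicalWindow p m L (F s.1) s.2.1 s.2.2 a b} ≤ (m + 1) * Real.exp (-L) := by
    intro a b hab hb
    have hms := (measurableSet_typicalWindow hFm p m L a b).compl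
    rw [measureReal_def]
    refine ENNReal.toReal_le_of_le_ofReal (by positivity) ?_
    rw [hP]
    refine (Measure.prod_apply hms).trans_le ?_
    -- Obliviousness enters here: for each outcome `ω` of the filler's randomness, the offsets and
    -- priorities keep their law.
    calc _ ≤ ∫⁻ _, ENNReal.ofReal ((m + 1) * Real.exp (-L)) ∂ν := by
          refine lintegral_mono fun ω => ?_
          refine (ENNReal.le_ofReal_iff_toReal_le (measure_ne_top _ _) (by positivity)).2 ?_
          exact prob_not_typicalWindow_le (hF ω) hL hm hab hb
      _ = _ := by simp
  -- The busy windows depend on the random run, so all windows are covered.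
  set I := (Finset.range (T + 1) ×ˢ Finset.range (T + 1)).filter fun ab => ab.1 ≤ ab.2
  have hsub : {s : Ω × (Fin n → ℝ) × (Fin n → ℝ) | ¬ ((∀ j, 0 ≤ s.2.1 j ∧ s.2.1 j < 1) ∧
      ∀ a b, a ≤ b → b ≤ T → TypicalWindow p m L (F s.1) s.2.1 s.2.2 a b)} ⊆
      {s | ¬ ∀ j, 0 ≤ s.2.1 j ∧ s.2.1 j < 1} ∪
        ⋃ ab ∈ I, {s | ¬ TypicalWindow p m L (F s.1) s.2.1 s.2.2 ab.1 ab.2} := by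
    intro s hs
    by_contra hc
    simp only [Set.mem_union, Set.mem_iUnion, not_or, not_exists, Set.mem_ofPred_eq, not_not] at hc
    refine hs ⟨hc.1, fun a b hab hb => hc.2 (a, b) ?_⟩
    simp only [I, Finset.mem_filter, Finset.mem_product, Finset.mem_range]
    omega
  have hI : (I.card : ℝ) ≤ (T + 1) ^ 2 := by
    have : I.card ≤ (T + 1) * (T + 1) :=
      (Finset.card_filter_le _ _).trans (by simp)
    rw [pow_two]
    exact_mod_cast this
  refine (measureReal_mono hsub).trans ((measureReal_union_le _ _).trans ?_)
  rw [hnull, zero_add]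
  refine (measureReal_biUnion_finset_le _ _).trans ?_
  refine (Finset.sum_le_card_nsmul _ _ ((m + 1) * Real.exp (-L)) fun ab hab => ?_).trans ?_
  · simp only [I, Finset.mem_filter, Finset.mem_product, Finset.mem_range] at hab
    exact hwin _ _ hab.2 (by omega)
  · rw [nsmul_eq_mul]
    exact mul_le_mul_of_nonneg_right hI (by positivity)

end CupGame

/-! ### Constants, bootstrapping and the failure probability -/

namespace CupGame

variable {n : ℕ}

lemma one_le_log {n : ℕ} (hn : 3 ≤ n) : 1.09 ≤ Real.log n := by
  have hn' : (3 : ℝ) ≤ n := by exact_mod_cast hn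
  rw [Real.le_log_iff_exp_le (by linarith)]
  refine le_trans ?_ hn'
  have h1 := Real.exp_one_lt_d9
  have h2 : Real.exp 0.09 ≤ 1 / (1 - 0.09) := by
    rw [le_div_iff₀ (by norm_num)]
    have h3 := Real.add_one_le_exp (-0.09 : ℝ)
    have h4 : Real.exp 0.09 * Real.exp (-0.09) = 1 := by rw [← Real.exp_add]; norm_num
    have h5 := Real.exp_pos 0.09
    nlinarith
  have h6 : Real.exp 1.09 = Real.exp 1 * Real.exp 0.09 := by rw [← Real.exp_add]; norm_num
  have h7 := Real.exp_pos 1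
  rw [h6]
  nlinarith

/-- Allows additive constants to be absorbed into `log log n`, which is small but positive at `n =
3`. -/
lemma one_le_mul_log_log {n : ℕ} (hn : 3 ≤ n) : 1 ≤ 13 * Real.log (Real.log n) := by
  have h := one_le_log hn
  have h1 := Real.one_sub_inv_le_log_of_pos (show (0 : ℝ) < 1.09 by norm_num)
  have h2 := Real.log_le_log (by norm_num) h
  norm_num at h1 h2 ⊢
  linarith

/-- The number of priority classes. -/
noncomputable def levels (n : ℕ) : ℕ := ⌈2 * Real.log (Real.log n)⌉₊

lemma one_le_levels {n : ℕ} (hn : 3 ≤ n) : 1 ≤ levels n :=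
  Nat.one_le_ceil_iff.2 (by linarith [one_le_mul_log_log hn])

lemma levels_le {n : ℕ} (hn : 3 ≤ n) : (levels n : ℝ) ≤ 2 * Real.log (Real.log n) + 1 :=
  (Nat.ceil_lt_add_one (by linarith [one_le_mul_log_log hn])).le

/-- The factor `2` in `levels` suffices because `2 * log 2 ≥ 1`. -/
lemma log_div_two_pow_levels_le {n : ℕ} (hn : 3 ≤ n) :
    Real.log n / 2 ^ levels n ≤ 1 := by
  have h := one_le_log hn
  rw [div_le_one (by positivity), ← Real.log_le_log_iff (by linarith) (by positivity), Real.log_pow]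
  have h1 : 2 * Real.log (Real.log n) ≤ levels n := Nat.le_ceil _
  have h2 := Real.log_two_gt_d9
  have h3 : (0 : ℝ) ≤ levels n := by positivity
  nlinarith

lemma tailSize_le (x : Fin n → ℝ) : tailSize x ≤ n := by
  rw [← two_le_card_eq_tailSize]
  exact (Finset.card_filter_le _ _).trans (by simp)

/-- If all windows are typical, then a bound `β` on the backlog implies a bound on the tail size. -/
lemma tailSize_le_of_typical {p T : ℕ} {L β : ℝ} {F : ℕ → Fin n → ℝ} {r prio : Fin n → ℝ}
    (hn : 3 ≤ n) (hF : IsFilling p T F) (hr : ∀ j, 0 ≤ r j ∧ r j < 1) (hL : 1 ≤ L) (hβ : 0 ≤ β)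
    (hfill : ∀ t ≤ T, ∀ j, fill p F r prio t j ≤ β)
    (hW : ∀ a b, a ≤ b → b ≤ T → TypicalWindow p (levels n) L F r prio a b) {t : ℕ} (ht : t ≤ T) :
    (tailSize (fill p F r prio t) : ℝ) ≤ 12 * (p * β + 16 * (L * levels n)) := by
  have h1 := tokenSum_le (by omega) hF hr hL (one_le_levels hn) hβ hfill hW le_rfl ht
  have h2 := tailSize_le_tokenSum (prio := prio) hF (fun j => (hr j).1)
    ((levels n : ℕ) / (levels n : ℕ) : ℝ) ht
  have h3 : Real.exp (Real.log n / 2 ^ levels n) ≤ 3 := by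
    refine (Real.exp_le_exp.2 (log_div_two_pow_levels_le hn)).trans ?_
    linarith [Real.exp_one_lt_d9]
  have h4 : 0 ≤ 4 * (p * β + 16 * (L * levels n)) := by positivity
  have h5 := mul_le_mul_of_nonneg_left h3 h4
  linarith

/-- The constant inside the logarithm of the backlog bound. -/
noncomputable def logConst (κ : ℝ) : ℝ := 12 * (26 + 48 * κ) + 2

/-- The constant of the backlog bound. -/
noncomputable def backlogConst (κ : ℝ) : ℝ := 146 + 104 * Real.log (logConst κ)

/-- The constant of the tail bound. -/
noncomputable def tailConst (κ : ℝ) : ℝ := 12 * (2 * backlogConst κ + 240 * κ)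

lemma backlogConst_ge {κ : ℝ} (hκ : 1 ≤ κ) : 146 ≤ backlogConst κ := by
  have : 0 ≤ Real.log (logConst κ) := Real.log_nonneg (by unfold logConst; linarith)
  unfold backlogConst
  linarith

/-- If all windows are typical, then the tail size and the backlog are as small as claimed. -/
theorem bounds_of_typical {p T : ℕ} {κ : ℝ} {F : ℕ → Fin n → ℝ} {r prio : Fin n → ℝ}
    (hn : 3 ≤ n) (hp : 1 ≤ p) (hκ : 1 ≤ κ) (hF : IsFilling p T F)
    (hr : ∀ j, 0 ≤ r j ∧ r j < 1)
    (hW : ∀ a b, a ≤ b → b ≤ T → TypicalWindow p (levels n) (κ * Real.log n) F r prio a b)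
    {t : ℕ} (ht : t ≤ T) :
    (tailSize (fill p F r prio t) : ℝ) ≤
      tailConst κ * (Real.log n * Real.log (Real.log n) + p * Real.log p) ∧
    ∀ j, fill p F r prio t j ≤ tailConst κ * (Real.log (Real.log n) + Real.log p) := by
  have hl := one_le_log hn
  have hll := one_le_mul_log_log hn
  have hlev := levels_le hn
  have hp' : (1 : ℝ) ≤ p := by exact_mod_cast hp
  have hn' : (3 : ℝ) ≤ n := by exact_mod_cast hn
  have hlp : 0 ≤ Real.log p := Real.log_nonneg hp'
  have hBC := backlogConst_ge hκ
  have hC : backlogConst κ ≤ tailConst κ := by unfold tailConst; linarith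
  have hlog_le : Real.log (Real.log n) ≤ Real.log n - 1 :=
    Real.log_le_sub_one_of_pos (by linarith)
  set ℓ := Real.log n with hℓ
  set lℓ := Real.log ℓ with hlℓ
  have hL : 1 ≤ κ * ℓ := by nlinarith
  -- The bound `p ≤ n` comes from the existence of a legal filler move, so a game without steps is
  -- treated apart.
  rcases Nat.eq_zero_or_pos T with hT | hT
  · obtain rfl : t = 0 := by omega
    constructor
    · have : tailSize (fill p F r prio 0) = 0 := by
        rw [← two_le_card_eq_tailSize, Finset.card_eq_zero, Finset.filter_eq_empty_iff]
        intro j _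
        have := (hr j).2
        simp only [fill]
        linarith
      rw [this, Nat.cast_zero]
      have : 0 ≤ ℓ * lℓ + p * Real.log p := by
        have : 0 ≤ ℓ * lℓ := mul_nonneg (by linarith) (by linarith)
        positivity
      exact mul_nonneg (by linarith) this
    · intro j
      have := (hr j).2
      simp only [fill]
      nlinarith
  have hpn : (p : ℝ) ≤ n := by
    have h0 := hF 0 hT
    rw [← h0.2]
    exact (Finset.sum_le_sum fun j _ => (h0.1 j).2).trans (by simp)
  -- the first pass
  have hb1 : ∀ t ≤ T, ∀ j, fill p F r prio t j ≤ 26 * ℓ := by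
    intro t ht j
    refine (fill_le_of_tailSize_le (S := n) hF (fun j => (hr j).2)
      (fun t _ => tailSize_le _) ht j).trans ?_
    have : Real.log (n + p + 1) ≤ 2 * ℓ := by
      have h2 : 2 * ℓ = Real.log ((n : ℝ) ^ 2) := by rw [Real.log_pow, hℓ]; norm_num
      rw [h2]
      exact Real.log_le_log (by positivity) (by nlinarith)
    linarith
  have hs1 : ∀ t ≤ T, (tailSize (fill p F r prio t) : ℝ) ≤ 12 * (26 + 48 * κ) * (p * ℓ ^ 2) := by
    intro t ht
    refine (tailSize_le_of_typical hn hF hr hL (by linarith) hb1 hW ht).trans ?_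
    have h1 : p * (26 * ℓ) ≤ 26 * (p * ℓ ^ 2) := by
      have : p * ℓ ≤ p * ℓ ^ 2 := mul_le_mul_of_nonneg_left (by nlinarith) (by linarith)
      linarith
    have h2 : 16 * (κ * ℓ * levels n) ≤ 48 * κ * (p * ℓ ^ 2) := by
      have h3 : (levels n : ℝ) ≤ 3 * ℓ := by linarith
      have h4 : κ * ℓ * levels n ≤ κ * ℓ * (3 * ℓ) :=
        mul_le_mul_of_nonneg_left h3 (by linarith)
      have h5 : κ * ℓ ^ 2 * 1 ≤ κ * ℓ ^ 2 * p := mul_le_mul_of_nonneg_left hp' (by positivity)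
      nlinarith
    linarith
  -- the second pass
  set S := ⌊12 * (26 + 48 * κ) * (p * ℓ ^ 2)⌋₊ with hS
  have hb2 : ∀ t ≤ T, ∀ j, fill p F r prio t j ≤ backlogConst κ * (lℓ + Real.log p) := by
    intro t ht j
    refine (fill_le_of_tailSize_le (S := S) hF (fun j => (hr j).2)
      (fun t ht => Nat.le_floor (hs1 t ht)) ht j).trans ?_
    have hSle : (S : ℝ) ≤ 12 * (26 + 48 * κ) * (p * ℓ ^ 2) := Nat.floor_le (by positivity)
    have hpl : (p : ℝ) ≤ p * ℓ ^ 2 := le_mul_of_one_le_right (by linarith) (by nlinarith)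
    have h1 : (S : ℝ) + p + 1 ≤ logConst κ * (p * ℓ ^ 2) := by
      unfold logConst
      linarith
    have hlc : 1 ≤ logConst κ := by unfold logConst; linarith
    have h2 : Real.log (S + p + 1) ≤ Real.log (logConst κ) + (Real.log p + 2 * lℓ) := by
      refine (Real.log_le_log (by positivity) h1).trans (le_of_eq ?_)
      rw [Real.log_mul (by linarith) (by positivity), Real.log_mul (by linarith) (by positivity),
        Real.log_pow]
      norm_num
      rfl
    have h3 := Real.log_nonneg hlc
    unfold backlogConst
    nlinarith
  refine ⟨?_, fun j => (hb2 t ht j).trans (mul_le_mul_of_nonneg_right hC (by linarith))⟩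
  refine (tailSize_le_of_typical hn hF hr hL (mul_nonneg (by linarith) (by linarith)) hb2 hW ht).trans ?_
  have hplp : 0 ≤ p * Real.log p := by positivity
  have hlll : 0 ≤ ℓ * lℓ := mul_nonneg (by linarith) (by linarith)
  -- The mixed term `p * log log n` is absorbed by the first summand if `p ≤ log n` and by the
  -- second otherwise.
  have h1 : p * lℓ ≤ ℓ * lℓ + p * Real.log p := by
    rcases le_total (p : ℝ) ℓ with h | h
    · have := mul_le_mul_of_nonneg_right h (show 0 ≤ lℓ by linarith)
      linarith
    · have := mul_le_mul_of_nonneg_left (Real.log_le_log (by linarith) h) (show (0 : ℝ) ≤ p by linarith)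
      linarith
  have h2 : p * (backlogConst κ * (lℓ + Real.log p)) ≤
      2 * backlogConst κ * (ℓ * lℓ + p * Real.log p) := by
    have : p * (lℓ + Real.log p) ≤ 2 * (ℓ * lℓ + p * Real.log p) := by linarith
    have := mul_le_mul_of_nonneg_left this (show 0 ≤ backlogConst κ by linarith)
    linarith
  have h3 : 16 * (κ * ℓ * levels n) ≤ 240 * κ * (ℓ * lℓ + p * Real.log p) := by
    have h4 : κ * ℓ * levels n ≤ κ * ℓ * (15 * lℓ) :=
      mul_le_mul_of_nonneg_left (by linarith) (by linarith)
    have h5 : 0 ≤ κ * (p * Real.log p) := mul_nonneg (by linarith) hplp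
    linarith
  unfold tailConst
  linarith

lemma failure_le {n T : ℕ} (c d : ℕ) (hn : 3 ≤ n) (hT : T ≤ n ^ d) :
    ((T : ℝ) + 1) ^ 2 * ((levels n + 1) *
      Real.exp (-(((c + 2 * d + 3 : ℕ) : ℝ) * Real.log n))) ≤ 1 / (n : ℝ) ^ c := by
  have hn' : (3 : ℝ) ≤ n := by exact_mod_cast hn
  have hnpos : (0 : ℝ) < n := by linarith
  have hT' : (T : ℝ) ≤ (n : ℝ) ^ d := by exact_mod_cast hT
  have h1 : (1 : ℝ) ≤ (n : ℝ) ^ d := one_le_pow₀ (by linarith)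
  have h2 : ((T : ℝ) + 1) ^ 2 ≤ (2 * (n : ℝ) ^ d) ^ 2 := by
    gcongr
    linarith
  have h3 : (levels n : ℝ) + 1 ≤ 2 * n := by
    have := levels_le hn
    have := Real.log_le_sub_one_of_pos (show 0 < Real.log n by linarith [one_le_log hn])
    have := Real.log_le_sub_one_of_pos hnpos
    linarith
  have h4 : Real.exp (-(((c + 2 * d + 3 : ℕ) : ℝ) * Real.log n)) =
      1 / (n : ℝ) ^ (c + 2 * d + 3) := by
    rw [Real.exp_neg, Real.exp_nat_mul, Real.exp_log hnpos, one_div]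
  rw [h4]
  calc _ ≤ (2 * (n : ℝ) ^ d) ^ 2 * ((2 * n) * (1 / (n : ℝ) ^ (c + 2 * d + 3))) := by gcongr
    _ = 8 / (n : ℝ) ^ 2 * (1 / (n : ℝ) ^ c) := by
        rw [pow_add, pow_add, pow_mul']
        field_simp
        ring
    _ ≤ 1 * (1 / (n : ℝ) ^ c) := by
        gcongr
        rw [div_le_one (by positivity)]
        nlinarith
    _ = _ := one_mul _

end CupGame

/-- High probability in `n` for games of polynomial length: for every exponent `c` of the failure
probability and every exponent `d` of the length, the implied constant `C` depends on `c` and `d`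
only. The filler is oblivious and may be randomized: its moves are a function of its own random
source `(Ω, ν)`, which is independent of the offsets `s.2.1` and the priorities `s.2.2` of the emptier. -/
theorem theorem4p7 (c d : ℕ) :
    ∃ C : ℝ, 0 < C ∧
      ∀ (n p T : ℕ), 3 ≤ n → 1 ≤ p → T ≤ n ^ d →
      ∀ (Ω : Type*) [MeasurableSpace Ω] (ν : Measure Ω) [IsProbabilityMeasure ν]
        (F : Ω → ℕ → Fin n → ℝ),
        (∀ t j, Measurable fun ω => F ω t j) →
        (∀ ω, CupGame.IsFilling p T (F ω)) →
        1 - 1 / (n : ℝ) ^ c ≤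
          (ν.prod ((CupGame.uniformVec n).prod (CupGame.uniformVec n))).real
            {s : Ω × (Fin n → ℝ) × (Fin n → ℝ) | ∀ t ≤ T,
              (CupGame.tailSize (CupGame.fill p (F s.1) s.2.1 s.2.2 t) : ℝ) ≤
                C * (Real.log n * Real.log (Real.log n) + p * Real.log p) ∧
              CupGame.backlog (CupGame.fill p (F s.1) s.2.1 s.2.2 t) ≤
                C * (Real.log (Real.log n) + Real.log p)} := by
  set κ : ℝ := ((c + 2 * d + 3 : ℕ) : ℝ) with hκ
  have hκ1 : 1 ≤ κ := by
    rw [hκ]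
    exact_mod_cast (by omega : 1 ≤ c + 2 * d + 3)
  have hC : 0 < CupGame.tailConst κ := by
    have := CupGame.backlogConst_ge hκ1
    unfold CupGame.tailConst
    linarith
  refine ⟨CupGame.tailConst κ, hC, ?_⟩
  intro n p T hn hp hT Ω _ ν _ F hFm hF
  have : Nonempty (Fin n) := ⟨⟨0, by omega⟩⟩
  have hbad := CupGame.prob_typical_ge (L := κ * Real.log n) ν hFm hF
    (by have := CupGame.one_le_log hn; positivity) (CupGame.one_le_levels hn)
  have hfail := hbad.trans (CupGame.failure_le c d hn hT)
  set P := ν.prod ((CupGame.uniformVec n).prod (CupGame.uniformVec n))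
  set Bad : Set (Ω × (Fin n → ℝ) × (Fin n → ℝ)) := {s | ¬ ((∀ j, 0 ≤ s.2.1 j ∧ s.2.1 j < 1) ∧
      ∀ a b, a ≤ b → b ≤ T → CupGame.TypicalWindow p (CupGame.levels n) (κ * Real.log n)
        (F s.1) s.2.1 s.2.2 a b)} with hBad
  set Good : Set (Ω × (Fin n → ℝ) × (Fin n → ℝ)) := _
  change 1 - 1 / (n : ℝ) ^ c ≤ P.real Good
  have hcover : Set.univ ⊆ Good ∪ Bad := by
    intro s _
    by_cases hs : s ∈ Bad
    · exact Or.inr hs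
    · left
      simp only [hBad, Set.mem_ofPred_eq, not_not] at hs
      intro t ht
      have := CupGame.bounds_of_typical hn hp hκ1 (hF s.1) hs.1 hs.2 ht
      exact ⟨this.1, ciSup_le this.2⟩
  -- Subadditivity needs no measurability of `Good` or `Bad`.
  have h1 : (1 : ℝ) ≤ P.real Good + P.real Bad := by
    rw [← probReal_univ (μ := P)]
    exact (measureReal_mono hcover).trans (measureReal_union_le _ _)
  linarith
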